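/- Let $n\ge 2$, let $\Omega\subset\mathbb R^n$ be a bounded domain (a nonempty, bounded, open, connected set), and write $d(y)=\operatorname{dist}(y,\partial\Omega)$. For $s\ge 1$ and $C_J\ge 1$, $\Omega$ is called an $s$-distance John domain with John constant $C_J$ if there is a point $x_J\in\Omega$ such that every $x\in\Omega$ can be joined to $x_J$ by a rectifiable curve $\gamma:[0,1]\to\Omega$ with $\gamma(0)=x$, $\gamma(1)=x_J$ and $C_J\,d(\gamma(t))>|\gamma(t)-x|^s$ for all $t\in[0,1]$. For $0<\alpha\le n$ and $U\subset\mathbb R^n$, let $$\mathcal H^\alpha_\infty(U)=\inf\Big\{\sum_{i=0}^\infty\omega_\alpha r_i^\alpha:\ U\subset\bigcup_{i=0}^\infty B(x_i,r_i),\ r_i>0\Big\},\qquad \omega_\alpha=\frac{\pi^{\alpha/2}}{\Gamma(\alpha/2+1)},$$ with open balls $B(x_i,r_i)$, be the Hausdorff content, and for $g:\Omega\to\mathbb R$ let $$\int_\Omega|g|\,d\mathcal H^\alpha_\infty=\int_0^\infty\mathcal H^\alpha_\infty(\{x\in\Omega:|g(x)|>t\})\,dt$$ be the Choquet integral. For $f\in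 L^1(\Omega)$ let $f_\Omega=\frac1{|\Omega|}\int_\Omega f\,dx$. A point $x\in\Omega$ is a Lebesgue point of $f$ if there is a (necessarily unique) $a\in\mathbb R$ with $\lim_{r\to0^+}\frac1{|B(x,r)|}\int_{B(x,r)}|f(y)-a|\,dy=0$. The precise representative $f^*$ of $f$ is defined by $f^*(x)=a$ at each Lebesgue point $x\in\Omega$; at the other points of $\Omega$ it may be given arbitrary real values. **Theorem (functional Boxing inequality).** Let $\delta,\tau\in(0,1)$ and let $\Omega\subset\mathbb R^n$ be an $s$-distance John domain with John constant $C_J$, where $1\le s\le\frac{n}{n-\delta}$. Then there is a constant $C>0$, depending only on $n,\tau,s,C_J$ and $\operatorname{diam}\Omega$ (in particular, not on $\delta$), such that for every $f\in L^1(\Omega)$ (and every choice of the values of $f^*$ at the points of $\Omega$ that are not Lebesgue points of $f$) $$\int_\Omega|f^*-f_\Omega|\,d\mathcal H^{s(n-\delta)}_\infty\ \le\ C(1-\delta)\int_\Omega\int_{\{x\in\Omega:\,|x-y|<\tau d(y)\}}\frac{|f(x)-f(y)|}{|x-y|^{n+\delta}}\,dx\,dy ,$$ where the right-hand side may be $+\infty$.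 -/

import Mathlib

open MeasureTheory Set Filter Topology
open scoped ENNReal

noncomputable section

/-- A bounded domain `Ω ⊆ ℝⁿ` is an `s`-distance John domain with John constant `CJ` if it has a
center `xJ` such that every `x ∈ Ω` is joined to `xJ` by a rectifiable curve `γ : [0, 1] → Ω` with
`CJ * dist (γ t) (∂Ω) > |γ t - x| ^ s` for all `t ∈ [0, 1]`. -/
def IsDistanceJohnDomain {n : ℕ} (s CJ : ℝ) (Ω : Set (EuclideanSpace ℝ (Fin n))) : Prop :=
  IsOpen Ω ∧ IsConnected Ω ∧ Bornology.IsBounded Ω ∧ 1 ≤ s ∧ 1 ≤ CJ ∧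
    ∃ xJ ∈ Ω, ∀ x ∈ Ω, ∃ γ : ℝ → EuclideanSpace ℝ (Fin n),
      ContinuousOn γ (Icc 0 1) ∧ BoundedVariationOn γ (Icc 0 1) ∧ MapsTo γ (Icc 0 1) Ω ∧
      γ 0 = x ∧ γ 1 = xJ ∧
      ∀ t ∈ Icc (0 : ℝ) 1, dist (γ t) x ^ s < CJ * Metric.infDist (γ t) (frontier Ω)

/-- The normalizing constant `ω_α = π ^ (α / 2) / Γ(α / 2 + 1)`. -/
def omegaConst (α : ℝ) : ℝ := Real.pi ^ (α / 2) / Real.Gamma (α / 2 + 1)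

/-- The `α`-dimensional Hausdorff content: the infimum of `∑ ω_α rᵢ ^ α` over all countable
coverings of `U` by open balls `B(xᵢ, rᵢ)`. -/
def hausdorffContent {n : ℕ} (α : ℝ) (U : Set (EuclideanSpace ℝ (Fin n))) : ℝ≥0∞ :=
  ⨅ (c : ℕ → EuclideanSpace ℝ (Fin n)) (r : ℕ → ℝ) (_ : ∀ i, 0 < r i)
    (_ : U ⊆ ⋃ i, Metric.ball (c i) (r i)), ∑' i, ENNReal.ofReal (omegaConst α * r i ^ α)

/-- The Choquet integral `∫_Ω |g| dℋ_∞^α = ∫_0^∞ ℋ_∞^α {x ∈ Ω | |g x| > t} dt`. -/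
def choquetIntegral {n : ℕ} (α : ℝ) (Ω : Set (EuclideanSpace ℝ (Fin n)))
    (g : EuclideanSpace ℝ (Fin n) → ℝ) : ℝ≥0∞ :=
  ∫⁻ t in Ioi (0 : ℝ), hausdorffContent α {x ∈ Ω | t < |g x|}

/-- `x` is a Lebesgue point of `f` with value `a`: the averages of `|f - a|` over the balls
`B(x, r)` tend to `0` as `r → 0+`. -/
def HasLebesgueValue {n : ℕ} (f : EuclideanSpace ℝ (Fin n) → ℝ) (x : EuclideanSpace ℝ (Fin n))
    (a : ℝ) : Prop :=
  Tendsto (fun r : ℝ => ⨍ y in Metric.ball x r, |f y - a|) (𝓝[>] 0) (𝓝 0)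

/-- `fstar` is the precise representative of `f` on `Ω`: it takes the Lebesgue value of `f` at each
Lebesgue point of `f` in `Ω`. The precise representative is determined on the set of Lebesgue
points only; the values of `fstar` elsewhere are arbitrary. -/
def IsPreciseRepresentative {n : ℕ} (Ω : Set (EuclideanSpace ℝ (Fin n)))
    (f fstar : EuclideanSpace ℝ (Fin n) → ℝ) : Prop :=
  ∀ x ∈ Ω, ∀ a : ℝ, HasLebesgueValue f x a → fstar x = a

/-- The improved fractional Sobolev energy
`∫_Ω ∫_{x ∈ Ω, |x - y| < τ d(y)} |f x - f y| / |x - y| ^ (n + δ) dx dy`,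
where `d(y)` is the distance from `y` to the boundary of `Ω`. -/
def improvedEnergy {n : ℕ} (δ τ : ℝ) (Ω : Set (EuclideanSpace ℝ (Fin n)))
    (f : EuclideanSpace ℝ (Fin n) → ℝ) : ℝ≥0∞ :=
  ∫⁻ y in Ω, ∫⁻ x in {x ∈ Ω | dist x y < τ * Metric.infDist y (frontier Ω)},
    ENNReal.ofReal (|f x - f y| / dist x y ^ ((n : ℝ) + δ))

end

/-!
The energy is additive over the superlevel sets `{u > t}` of `u` (coarea formula,
`measurable_levelEnergy_and_coarea`), so the inequality reduces to sets: it is enough to bound the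
Hausdorff content of the points around which a set `E` has density at least `1 / 2`
(`halfDensitySet`) by the energy of the indicator of `E`, when `E` fills at most half of a ball
around the John center (`hausdorffContent_le_energy_indicator`). Given such a point `x`, the
density of `E` in `B(z, τ d(z) / 4)` is continuous in `z` along the John curve of `x`, and the
density in `B(x, r)` is continuous in `r`; hence `E` fills exactly half of some ball `B(z, r)`
with `|z - x| ^ s ≤ C r`. There the Poincaré inequality on balls gives `r ^ (n - δ) ≤ C (1 - δ)
ν(B(z, r))`, where `ν` is the energy measure of the indicator, and since `x` lies in the ball
around `z` of radius comparable to `r ^ (1 / s)`, a Vitali covering yields the bound.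

The factor `1 - δ` comes from the Poincaré inequality `lintegral_osc_le_energy`: on a convex set
the oscillation of `u` over pairs at distance less than `ρ` is at most `2 ^ (n + 1)` times the one
at distance less than `ρ / 2`, so each dyadic scale of the kernel contributes a term of a
geometric series of ratio `2 ^ (δ - 1)`.

Points that are not Lebesgue points have content zero (`hausdorffContent_not_lebesgue_eq_zero`):
sets of positive oscillation at small scales are null for the energy measure and hence for the
content, and this applied to `u` and to countably many indicators of `{u > t}` forces the averages
to converge.

The inequality is first obtained with a median of `u` on the central ball in place of the mean on
`Ω`; the difference of the two is bounded by comparing Lebesgue measure with the content.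
-/

/-! ### A Poincaré inequality with the factor `1 - δ` on convex sets -/

/-- The integral of `|u x - u y|` over the pairs of points of `B` at distance less than `ρ`. -/
noncomputable def truncOsc {n : ℕ} (u : EuclideanSpace ℝ (Fin n) → ℝ)
    (B : Set (EuclideanSpace ℝ (Fin n))) (ρ : ℝ) : ℝ≥0∞ :=
  ∫⁻ x in B, ∫⁻ y in B, {y | dist x y < ρ}.indicator (fun y => ENNReal.ofReal |u x - u y|) y

lemma exists_measurable_truncKernel {n : ℕ} {u : EuclideanSpace ℝ (Fin n) → ℝ}
    (hu : Measurable u) :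
    ∃ G : ℝ → EuclideanSpace ℝ (Fin n) × EuclideanSpace ℝ (Fin n) → ℝ≥0∞,
      (∀ ρ, Measurable (G ρ)) ∧ ∀ ρ x y, G ρ (x, y) =
        {y | dist x y < ρ}.indicator (fun y => ENNReal.ofReal |u x - u y|) y :=
  ⟨fun ρ => {q | dist q.1 q.2 < ρ}.indicator (fun q => ENNReal.ofReal |u q.1 - u q.2|),
    fun _ => Measurable.indicator (by fun_prop) (measurableSet_lt measurable_dist measurable_const),
    fun _ _ _ => rfl⟩

lemma lintegral_comp_midpoint {n : ℕ} (x : EuclideanSpace ℝ (Fin n))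
    (h : EuclideanSpace ℝ (Fin n) → ℝ≥0∞) (hh : Measurable h) :
    ∫⁻ y, h (midpoint ℝ x y) = 2 ^ n * ∫⁻ y, h y := by
  have h1 : ∀ y, midpoint ℝ x y = (2⁻¹ : ℝ) • (x + y) := by
    intro y; rw [midpoint_eq_smul_add, invOf_eq_inv]
  simp_rw [h1]
  rw [lintegral_add_left_eq_self (fun z => h ((2⁻¹ : ℝ) • z)) x,
    ← lintegral_map hh (measurable_const_smul (2⁻¹ : ℝ)),
    Measure.map_addHaar_smul _ (by norm_num), lintegral_smul_measure]
  congr 1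
  simp [abs_of_pos]

/-- Passing through the midpoint of `x` and `y` halves the distance. -/
lemma truncOsc_le_half {n : ℕ} {u : EuclideanSpace ℝ (Fin n) → ℝ} (hu : Measurable u)
    {B : Set (EuclideanSpace ℝ (Fin n))} (hB : Convex ℝ B) (hBm : MeasurableSet B) (ρ : ℝ) :
    truncOsc u B ρ ≤ 2 ^ (n + 1) * truncOsc u B (ρ / 2) := by
  let F : ℝ → EuclideanSpace ℝ (Fin n) × EuclideanSpace ℝ (Fin n) → ℝ≥0∞ := fun ρ =>
    ({p : EuclideanSpace ℝ (Fin n) × EuclideanSpace ℝ (Fin n) | p.1 ∈ B ∧ p.2 ∈ B ∧ dist p.1 p.2 < ρ}).indicator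
      (fun p => ENNReal.ofReal |u p.1 - u p.2|)
  have hF : ∀ ρ, Measurable (F ρ) := by
    intro ρ
    refine Measurable.indicator (by fun_prop) ?_
    exact (measurable_fst hBm).inter ((measurable_snd hBm).inter
      (measurableSet_lt measurable_dist measurable_const))
  have hFpos : ∀ {ρ x y}, x ∈ B → y ∈ B → dist x y < ρ →
      F ρ (x, y) = ENNReal.ofReal |u x - u y| := by
    intro ρ x y hx hy hd
    simp [F, hx, hy, hd]
  have key : ∀ ρ, truncOsc u B ρ = ∫⁻ x, ∫⁻ y, F ρ (x, y) := by
    intro ρ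
    rw [truncOsc, ← lintegral_indicator hBm]
    refine lintegral_congr fun x => ?_
    by_cases hx : x ∈ B
    · rw [indicator_of_mem hx, ← lintegral_indicator hBm]
      refine lintegral_congr fun y => ?_
      by_cases hy : y ∈ B <;> by_cases hd : dist x y < ρ <;> simp [F, indicator, hx, hy, hd]
    · rw [indicator_of_notMem hx]
      simp [F, hx]
  rw [key, key]
  have step : ∀ x y, F ρ (x, y) ≤ F (ρ / 2) (x, midpoint ℝ x y) + F (ρ / 2) (y, midpoint ℝ y x) := by
    intro x y
    by_cases h : x ∈ B ∧ y ∈ B ∧ dist x y < ρ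
    · obtain ⟨hx, hy, hd⟩ := h
      have hm : midpoint ℝ x y ∈ B := hB.midpoint_mem hx hy
      have hm' : midpoint ℝ y x ∈ B := hB.midpoint_mem hy hx
      have d1 : dist x (midpoint ℝ x y) < ρ / 2 := by
        rw [dist_left_midpoint]; norm_num; linarith
      have d2 : dist y (midpoint ℝ y x) < ρ / 2 := by
        rw [dist_left_midpoint, dist_comm]; norm_num; linarith
      have e : F ρ (x, y) = ENNReal.ofReal |u x - u y| := hFpos hx hy hd
      have e1 : F (ρ / 2) (x, midpoint ℝ x y) = ENNReal.ofReal |u x - u (midpoint ℝ x y)| :=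
        hFpos hx hm d1
      have e2 : F (ρ / 2) (y, midpoint ℝ y x) = ENNReal.ofReal |u y - u (midpoint ℝ y x)| :=
        hFpos hy hm' d2
      rw [e, e1, e2, midpoint_comm (R := ℝ) y x, ← ENNReal.ofReal_add (abs_nonneg _) (abs_nonneg _)]
      refine ENNReal.ofReal_le_ofReal ?_
      rw [abs_sub_comm (u y)]
      exact abs_sub_le _ _ _
    · have : F ρ (x, y) = 0 := by
        simp only [F]; rw [indicator_of_notMem]; exact h
      rw [this]; exact zero_le
  have hmid : Measurable fun p : EuclideanSpace ℝ (Fin n) × EuclideanSpace ℝ (Fin n) => midpoint ℝ p.1 p.2 := by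
    simp_rw [midpoint_eq_smul_add]; fun_prop
  have hG : Measurable fun p : EuclideanSpace ℝ (Fin n) × EuclideanSpace ℝ (Fin n) => F (ρ / 2) (p.1, midpoint ℝ p.1 p.2) :=
    (hF _).comp (measurable_fst.prodMk hmid)
  calc ∫⁻ x, ∫⁻ y, F ρ (x, y)
      ≤ ∫⁻ x, ∫⁻ y, (F (ρ / 2) (x, midpoint ℝ x y) + F (ρ / 2) (y, midpoint ℝ y x)) :=
        lintegral_mono fun x => lintegral_mono fun y => step x y
    _ = (∫⁻ x, ∫⁻ y, F (ρ / 2) (x, midpoint ℝ x y))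
        + ∫⁻ x, ∫⁻ y, F (ρ / 2) (y, midpoint ℝ y x) := by
        rw [← lintegral_add_left]
        · refine lintegral_congr fun x => ?_
          rw [lintegral_add_left]
          exact hG.comp measurable_prodMk_left
        · exact hG.lintegral_prod_right'
    _ = (∫⁻ x, ∫⁻ y, F (ρ / 2) (x, midpoint ℝ x y))
        + ∫⁻ x, ∫⁻ y, F (ρ / 2) (x, midpoint ℝ x y) := by
        congr 1
        exact lintegral_lintegral_swap (f := fun x y => F (ρ / 2) (y, midpoint ℝ y x))
          (hG.comp measurable_swap).aemeasurable
    _ = 2 ^ (n + 1) * ∫⁻ x, ∫⁻ y, F (ρ / 2) (x, y) := by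
        have : ∀ x, ∫⁻ y, F (ρ / 2) (x, midpoint ℝ x y) = 2 ^ n * ∫⁻ y, F (ρ / 2) (x, y) :=
          fun x => lintegral_comp_midpoint x (fun y => F (ρ / 2) (x, y))
            ((hF _).comp measurable_prodMk_left)
        simp_rw [this]
        rw [lintegral_const_mul _ (hF _).lintegral_prod_right']
        ring

lemma truncOsc_le_pow {n : ℕ} {u : EuclideanSpace ℝ (Fin n) → ℝ} (hu : Measurable u)
    {B : Set (EuclideanSpace ℝ (Fin n))} (hB : Convex ℝ B) (hBm : MeasurableSet B) (ρ : ℝ) (k : ℕ) :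
    truncOsc u B ρ ≤ (2 ^ (n + 1)) ^ k * truncOsc u B (ρ / 2 ^ k) := by
  induction k with
  | zero => simp
  | succ k ih =>
    refine ih.trans ?_
    rw [pow_succ (2 ^ (n + 1) : ℝ≥0∞), mul_assoc, pow_succ (2 : ℝ), ← div_div]
    gcongr
    exact truncOsc_le_half hu hB hBm _

/-- The dyadic sum `∑ 2 ^ (p k)` over the `k` with `2 ^ k ρ < D` is dominated by its last term. -/
lemma sum_dyadic_le {p D ρ : ℝ} (hp : 1 ≤ p) (hρ : 0 < ρ) (hD : 0 < D) (N : ℕ) :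
    ∑ k ∈ Finset.range N, (if ρ < D / 2 ^ k then ((2 : ℝ) ^ p) ^ k else 0) ≤
      2 * (D ^ p / ρ ^ p) := by
  have hq : (2 : ℝ) ≤ 2 ^ p := by
    simpa using Real.rpow_le_rpow_of_exponent_le (x := 2) (by norm_num) hp
  induction N with
  | zero => simp; positivity
  | succ N ih =>
    rw [Finset.sum_range_succ]
    by_cases h : ρ < D / 2 ^ N
    · have geom : ∀ M : ℕ, ∑ k ∈ Finset.range (M + 1), ((2 : ℝ) ^ p) ^ k ≤ 2 * ((2 : ℝ) ^ p) ^ M := by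
        intro M
        induction M with
        | zero => simp
        | succ M ihM =>
          rw [Finset.sum_range_succ, pow_succ]
          have : 0 ≤ ((2 : ℝ) ^ p) ^ M := by positivity
          nlinarith
      have h1 : ((2 : ℝ) ^ p) ^ N ≤ D ^ p / ρ ^ p := by
        rw [← Real.div_rpow hD.le hρ.le, ← Real.rpow_natCast, ← Real.rpow_mul (by norm_num),
          mul_comm p, Real.rpow_mul (by norm_num), Real.rpow_natCast]
        refine Real.rpow_le_rpow (by positivity) ?_ (by linarith)
        rw [le_div_iff₀ hρ]
        rw [lt_div_iff₀ (by positivity)] at h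
        linarith
      have h2 := geom N
      rw [Finset.sum_range_succ] at h2
      rw [if_pos h]
      have h3 : ∑ k ∈ Finset.range N, (if ρ < D / 2 ^ k then ((2 : ℝ) ^ p) ^ k else 0) ≤
          ∑ k ∈ Finset.range N, ((2 : ℝ) ^ p) ^ k := by
        refine Finset.sum_le_sum fun k _ => ?_
        split_ifs
        · exact le_rfl
        · positivity
      linarith
    · rw [if_neg h]; linarith

lemma one_sub_two_rpow_le {δ : ℝ} (hδ : δ ≤ 1) : 1 - (2 : ℝ) ^ (δ - 1) ≤ 1 - δ := by
  have h1 := Real.add_one_le_exp (Real.log 2 * (δ - 1))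
  rw [← Real.rpow_def_of_pos (by norm_num)] at h1
  have h2 := Real.log_two_lt_d9
  nlinarith

/-- Poincaré inequality for the fractional energy of order `δ` on a convex set, with the factor
`1 - δ`. The truncated oscillations at the scales `2⁻ᵏ D` are all comparable to the full one,
and summing them with the weights of the kernel gives a geometric series of ratio `2 ^ (δ - 1)`. -/
lemma lintegral_osc_le_energy {n : ℕ} (hn : 1 ≤ n) {u : EuclideanSpace ℝ (Fin n) → ℝ}
    (hu : Measurable u)
    {B : Set (EuclideanSpace ℝ (Fin n))} (hB : Convex ℝ B) (hBm : MeasurableSet B) {D δ : ℝ}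
    (hδ : δ ∈ Ioo (0 : ℝ) 1) (hD : 0 < D) (hdist : ∀ x ∈ B, ∀ y ∈ B, dist x y < D) :
    ∫⁻ x in B, ∫⁻ y in B, ENNReal.ofReal |u x - u y| ≤
      ENNReal.ofReal (2 * (1 - δ) * D ^ ((n : ℝ) + δ)) *
        ∫⁻ x in B, ∫⁻ y in B, ENNReal.ofReal (|u x - u y| / dist x y ^ ((n : ℝ) + δ)) := by
  obtain ⟨hδ0, hδ1⟩ := hδ
  set p : ℝ := (n : ℝ) + δ with hp
  have hn' : (1 : ℝ) ≤ n := by exact_mod_cast hn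
  have hp1 : 1 ≤ p := by rw [hp]; linarith
  set lam : ℝ := 2 ^ (δ - 1) with hlam
  have hlam0 : 0 < lam := by positivity
  have hlam1 : lam < 1 := Real.rpow_lt_one_of_one_lt_of_neg (by norm_num) (by linarith)
  set A := ∫⁻ x in B, ∫⁻ y in B, ENNReal.ofReal |u x - u y| with hA
  set I := ∫⁻ x in B, ∫⁻ y in B, ENNReal.ofReal (|u x - u y| / dist x y ^ p) with hI
  have h0 : truncOsc u B D = A := by
    refine setLIntegral_congr_fun hBm fun x hx => setLIntegral_congr_fun hBm fun y hy => ?_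
    exact indicator_of_mem (show y ∈ {y | dist x y < D} from hdist x hx y hy) _
  have hk : ∀ k : ℕ, ENNReal.ofReal lam ^ k * A ≤
      ENNReal.ofReal (((2 : ℝ) ^ p) ^ k) * truncOsc u B (D / 2 ^ k) := by
    intro k
    rw [← h0]
    calc ENNReal.ofReal lam ^ k * truncOsc u B D
        ≤ ENNReal.ofReal lam ^ k * ((2 ^ (n + 1)) ^ k * truncOsc u B (D / 2 ^ k)) := by
          gcongr; exact truncOsc_le_pow hu hB hBm D k
      _ = _ := by
          rw [← mul_assoc, ← mul_pow, ENNReal.ofReal_pow (by positivity)]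
          congr 2
          rw [show (2 : ℝ≥0∞) ^ (n + 1) = ENNReal.ofReal (2 ^ (n + 1)) by
            rw [ENNReal.ofReal_pow (by norm_num)]; simp, ← ENNReal.ofReal_mul hlam0.le]
          congr 1
          rw [hlam, ← Real.rpow_natCast, ← Real.rpow_add (by norm_num)]
          congr 1
          push_cast; rw [hp]; ring
  obtain ⟨G, hG, hGval⟩ := exists_measurable_truncKernel hu
  have hsum : ∑' k : ℕ, ENNReal.ofReal (((2 : ℝ) ^ p) ^ k) * truncOsc u B (D / 2 ^ k) ≤
      ENNReal.ofReal (2 * D ^ p) * I := by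
    have hGx : ∀ ρ x, Measurable fun y => G ρ (x, y) := fun ρ x => (hG ρ).comp measurable_prodMk_left
    have e0 : ∀ ρ, truncOsc u B ρ = ∫⁻ x in B, ∫⁻ y in B, G ρ (x, y) := by
      intro ρ
      rw [truncOsc]
      simp_rw [hGval]
    have e1 : ∀ k : ℕ, ENNReal.ofReal (((2 : ℝ) ^ p) ^ k) * truncOsc u B (D / 2 ^ k) =
        ∫⁻ x in B, ∫⁻ y in B, ENNReal.ofReal (((2 : ℝ) ^ p) ^ k) * G (D / 2 ^ k) (x, y) := by
      intro k
      rw [e0, ← lintegral_const_mul _ (hG _).lintegral_prod_right']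
      refine lintegral_congr fun x => ?_
      rw [lintegral_const_mul _ (hGx _ x)]
    simp_rw [e1]
    rw [← lintegral_tsum (fun k => ((hG _).const_mul _).lintegral_prod_right'.aemeasurable)]
    rw [hI, ← lintegral_const_mul' _ _ ENNReal.ofReal_ne_top]
    refine lintegral_mono fun x => ?_
    rw [← lintegral_tsum (fun k =>
      ((hGx _ x).const_mul _).aemeasurable)]
    simp_rw [hGval]
    rw [← lintegral_const_mul' _ _ ENNReal.ofReal_ne_top]
    refine lintegral_mono fun y => ?_
    rw [← ENNReal.ofReal_mul (by positivity)]
    rcases eq_or_ne x y with rfl | hxy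
    · simp [indicator]
    have hρ : 0 < dist x y := dist_pos.2 hxy
    refine ENNReal.tsum_le_of_sum_range_le fun N => ?_
    have e2 : ∀ k : ℕ, ENNReal.ofReal (((2 : ℝ) ^ p) ^ k) *
          ({y | dist x y < D / 2 ^ k} : Set (EuclideanSpace ℝ (Fin n))).indicator (fun y => ENNReal.ofReal |u x - u y|) y =
        ENNReal.ofReal ((if dist x y < D / 2 ^ k then ((2 : ℝ) ^ p) ^ k else 0) * |u x - u y|) := by
      intro k
      by_cases h : dist x y < D / 2 ^ k
      · rw [indicator_of_mem (show y ∈ {y | dist x y < D / 2 ^ k} from h), if_pos h,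
          ENNReal.ofReal_mul (by positivity)]
      · rw [indicator_of_notMem (show y ∉ {y | dist x y < D / 2 ^ k} from h), if_neg h]
        simp
    simp_rw [e2]
    rw [← ENNReal.ofReal_sum_of_nonneg (fun k _ => by
      refine mul_nonneg ?_ (abs_nonneg _)
      split_ifs <;> positivity)]
    refine ENNReal.ofReal_le_ofReal ?_
    rw [← Finset.sum_mul]
    calc _ ≤ 2 * (D ^ p / dist x y ^ p) * |u x - u y| := by
          gcongr; exact sum_dyadic_le hp1 hρ hD N
      _ = _ := by ring
  have hgeom : (1 - ENNReal.ofReal lam)⁻¹ * A ≤ ENNReal.ofReal (2 * D ^ p) * I := by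
    rw [← ENNReal.tsum_geometric, ← ENNReal.tsum_mul_right]
    exact (ENNReal.tsum_le_tsum hk).trans hsum
  have h1lam : 1 - ENNReal.ofReal lam = ENNReal.ofReal (1 - lam) := by
    rw [ENNReal.ofReal_sub _ hlam0.le, ENNReal.ofReal_one]
  rw [h1lam] at hgeom
  have hne : ENNReal.ofReal (1 - lam) ≠ 0 := by simp; linarith
  calc A = ENNReal.ofReal (1 - lam) * ((ENNReal.ofReal (1 - lam))⁻¹ * A) := by
        rw [← mul_assoc, ENNReal.mul_inv_cancel hne ENNReal.ofReal_ne_top, one_mul]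
    _ ≤ ENNReal.ofReal (1 - δ) * (ENNReal.ofReal (2 * D ^ p) * I) := by
        exact mul_le_mul' (ENNReal.ofReal_le_ofReal (one_sub_two_rpow_le hδ1.le)) hgeom
    _ = _ := by
        rw [← mul_assoc, ← ENNReal.ofReal_mul (by linarith)]
        congr 2; ring

/-! ### The Hausdorff content -/

lemma omegaConst_pos {α : ℝ} (hα : 0 ≤ α) : 0 < omegaConst α := by
  unfold omegaConst
  have := Real.Gamma_pos_of_pos (s := α / 2 + 1) (by linarith)
  have := Real.pi_pos
  positivity

lemma exists_omegaConst_bounds (n : ℕ) :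
    ∃ a b : ℝ, 0 < a ∧ ∀ α ∈ Icc (0 : ℝ) n, a ≤ omegaConst α ∧ omegaConst α ≤ b := by
  have hcont : ContinuousOn omegaConst (Icc (0 : ℝ) n) := by
    intro α hα
    have h1 : 0 < α / 2 + 1 := by linarith [hα.1]
    have hG : ContinuousAt Real.Gamma (α / 2 + 1) :=
      (Real.differentiableAt_Gamma fun m => by
        have : (0 : ℝ) ≤ m := m.cast_nonneg
        linarith).continuousAt
    have hG' : ContinuousAt (fun α : ℝ => Real.Gamma (α / 2 + 1)) α :=
      ContinuousAt.comp (f := fun α : ℝ => α / 2 + 1) hG (by fun_prop)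
    have hp : ContinuousAt (fun α : ℝ => Real.pi ^ (α / 2)) α :=
      ContinuousAt.rpow (by fun_prop) (by fun_prop) (Or.inl Real.pi_ne_zero)
    exact (hp.div hG' (Real.Gamma_pos_of_pos h1).ne').continuousWithinAt
  have hne : (Icc (0 : ℝ) n).Nonempty := ⟨0, by simp⟩
  obtain ⟨x, hx, hmin⟩ := isCompact_Icc.exists_isMinOn hne hcont
  obtain ⟨y, hy, hmax⟩ := isCompact_Icc.exists_isMaxOn hne hcont
  exact ⟨omegaConst x, omegaConst y, omegaConst_pos hx.1, fun α hα => ⟨hmin hα, hmax hα⟩⟩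

lemma hausdorffContent_mono {n : ℕ} (α : ℝ) {U V : Set (EuclideanSpace ℝ (Fin n))} (h : U ⊆ V) :
    hausdorffContent α U ≤ hausdorffContent α V := by
  unfold hausdorffContent
  exact iInf_mono fun c => iInf_mono fun r => iInf_mono fun hr =>
    le_iInf fun hV => iInf_le _ (h.trans hV)

/-- Coverings by any countable family of balls, finite ones included, may be used to estimate the
Hausdorff content: the missing balls are chosen tiny. -/
lemma hausdorffContent_le_tsum {n : ℕ} {ι : Type*} [Countable ι] {α : ℝ} (hα : 0 < α)
    {U : Set (EuclideanSpace ℝ (Fin n))} {c : ι → EuclideanSpace ℝ (Fin n)} {r : ι → ℝ}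
    (hr : ∀ i, 0 < r i) (hU : U ⊆ ⋃ i, Metric.ball (c i) (r i)) :
    hausdorffContent α U ≤ ∑' i, ENNReal.ofReal (omegaConst α * r i ^ α) := by
  refine ENNReal.le_of_forall_pos_le_add fun ε hε _ => ?_
  obtain ⟨e, he⟩ := exists_injective_nat ι
  obtain ⟨ε', hε', hsum⟩ := ENNReal.exists_pos_sum_of_countable
    (ENNReal.coe_ne_zero.2 hε.ne') ℕ
  have hω := omegaConst_pos hα.le
  let ρ : ℕ → ℝ := fun k => ((ε' k : ℝ) / omegaConst α) ^ α⁻¹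
  have hρ : ∀ k, 0 < ρ k := fun k =>
    Real.rpow_pos_of_pos (div_pos (NNReal.coe_pos.2 (hε' k)) hω) _
  have hρ' : ∀ k, omegaConst α * ρ k ^ α = ε' k := by
    intro k
    have : 0 ≤ (ε' k : ℝ) / omegaConst α := by positivity
    simp only [ρ]
    rw [← Real.rpow_mul this, inv_mul_cancel₀ hα.ne', Real.rpow_one]
    field_simp
  let c' := Function.extend e c 0
  let r' := Function.extend e r ρ
  have hr' : ∀ k, 0 < r' k := by
    intro k
    by_cases h : ∃ i, e i = k
    · obtain ⟨i, rfl⟩ := h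
      simp only [r', he.extend_apply, hr]
    · simp only [r', Function.extend_apply' _ _ _ h, hρ]
  have hcov : U ⊆ ⋃ k, Metric.ball (c' k) (r' k) := by
    intro x hx
    obtain ⟨i, hi⟩ := mem_iUnion.1 (hU hx)
    refine mem_iUnion.2 ⟨e i, ?_⟩
    simpa only [c', r', he.extend_apply] using hi
  calc hausdorffContent α U ≤ ∑' k, ENNReal.ofReal (omegaConst α * r' k ^ α) :=
        iInf_le_of_le c' (iInf_le_of_le r' (iInf_le_of_le hr' (iInf_le _ hcov)))
    _ ≤ ∑' k, (Function.extend e (fun i => ENNReal.ofReal (omegaConst α * r i ^ α)) 0 k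
          + (ε' k : ℝ≥0∞)) := by
        refine ENNReal.tsum_le_tsum fun k => ?_
        by_cases h : ∃ i, e i = k
        · obtain ⟨i, rfl⟩ := h
          simp only [r', he.extend_apply]
          exact le_self_add
        · simp only [r', Function.extend_apply' _ _ _ h, hρ']
          simp
    _ ≤ _ := by
        rw [ENNReal.tsum_add, tsum_extend_zero he]
        gcongr

lemma hausdorffContent_iUnion_le {n : ℕ} {ι : Type*} [Countable ι] {α : ℝ} (hα : 0 < α)
    (U : ι → Set (EuclideanSpace ℝ (Fin n))) :
    hausdorffContent α (⋃ i, U i) ≤ ∑' i, hausdorffContent α (U i) := by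
  refine ENNReal.le_of_forall_pos_le_add fun ε hε hfin => ?_
  obtain ⟨ε', hε', hsum⟩ := ENNReal.exists_pos_sum_of_countable
    (ENNReal.coe_ne_zero.2 hε.ne') ι
  have hex : ∀ i, ∃ (c : ℕ → EuclideanSpace ℝ (Fin n)) (r : ℕ → ℝ), (∀ k, 0 < r k) ∧
      U i ⊆ ⋃ k, Metric.ball (c k) (r k) ∧
      ∑' k, ENNReal.ofReal (omegaConst α * r k ^ α) < hausdorffContent α (U i) + ε' i := by
    intro i
    have h1 : hausdorffContent α (U i) < hausdorffContent α (U i) + ε' i :=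
      ENNReal.lt_add_right ((ENNReal.le_tsum i).trans_lt hfin).ne
        (ENNReal.coe_ne_zero.2 (hε' i).ne')
    conv_lhs at h1 => unfold hausdorffContent
    simp only [iInf_lt_iff] at h1
    obtain ⟨c, r, hr, hU, h⟩ := h1
    exact ⟨c, r, hr, hU, h⟩
  choose c r hr hU hlt using hex
  calc hausdorffContent α (⋃ i, U i)
      ≤ ∑' p : ι × ℕ, ENNReal.ofReal (omegaConst α * r p.1 p.2 ^ α) := by
        refine hausdorffContent_le_tsum hα (c := fun p : ι × ℕ => c p.1 p.2)
          (fun p => hr p.1 p.2) ?_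
        refine iUnion_subset fun i x hx => ?_
        obtain ⟨k, hk⟩ := mem_iUnion.1 (hU i hx)
        exact mem_iUnion.2 ⟨(i, k), hk⟩
    _ = ∑' i, ∑' k, ENNReal.ofReal (omegaConst α * r i k ^ α) :=
        ENNReal.tsum_prod (f := fun i k => ENNReal.ofReal (omegaConst α * r i k ^ α))
    _ ≤ ∑' i, (hausdorffContent α (U i) + ε' i) := ENNReal.tsum_le_tsum fun i => (hlt i).le
    _ ≤ _ := by
        rw [ENNReal.tsum_add]
        gcongr

lemma hausdorffContent_union_le {n : ℕ} {α : ℝ} (hα : 0 < α)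
    (U V : Set (EuclideanSpace ℝ (Fin n))) :
    hausdorffContent α (U ∪ V) ≤ hausdorffContent α U + hausdorffContent α V := by
  rw [union_eq_iUnion]
  refine (hausdorffContent_iUnion_le hα _).trans ?_
  rw [tsum_bool]
  simp [add_comm]

lemma hausdorffContent_ball_le {n : ℕ} {α : ℝ} (hα : 0 < α) (x : EuclideanSpace ℝ (Fin n)) {R : ℝ}
    (hR : 0 < R) :
    hausdorffContent α (Metric.ball x R) ≤ ENNReal.ofReal (omegaConst α * R ^ α) := by
  refine (hausdorffContent_le_tsum hα (ι := Unit) (c := fun _ => x) (r := fun _ => R)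
    (fun _ => hR) (subset_iUnion (fun _ : Unit => Metric.ball x R) ())).trans ?_
  simp

/-- Lebesgue measure is bounded by the Hausdorff content of any dimension `α ≤ n` on bounded
sets. -/
lemma volume_le_hausdorffContent {n : ℕ} {α : ℝ} (hα : 0 < α) (hαn : α ≤ n)
    {U : Set (EuclideanSpace ℝ (Fin n))} {x : EuclideanSpace ℝ (Fin n)} {R : ℝ} (hR : 0 < R)
    (hU : U ⊆ Metric.ball x R) :
    volume U ≤ volume (Metric.ball (0 : EuclideanSpace ℝ (Fin n)) 1) *
      ENNReal.ofReal (R ^ ((n : ℝ) - α) / omegaConst α) * hausdorffContent α U := by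
  have hω := omegaConst_pos hα.le
  set v := volume (Metric.ball (0 : EuclideanSpace ℝ (Fin n)) 1) with hv
  set K := v * ENNReal.ofReal (R ^ ((n : ℝ) - α) / omegaConst α) with hK
  have hv0 : v ≠ 0 := (Metric.measure_ball_pos _ _ one_pos).ne'
  have hK0 : K ≠ 0 := mul_ne_zero hv0 (by
    rw [Ne, ENNReal.ofReal_eq_zero, not_le]; positivity)
  have hKt : K ≠ ⊤ := ENNReal.mul_ne_top measure_ball_lt_top.ne ENNReal.ofReal_ne_top
  rw [← ENNReal.div_le_iff' hK0 hKt]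
  unfold hausdorffContent
  refine le_iInf fun c => le_iInf fun r => le_iInf fun hr => le_iInf fun hcov => ?_
  rw [ENNReal.div_le_iff' hK0 hKt, ← ENNReal.tsum_mul_left]
  have hball : ∀ (y : EuclideanSpace ℝ (Fin n)) (ρ : ℝ), 0 < ρ →
      volume (Metric.ball y ρ) = v * ENNReal.ofReal (ρ ^ n) := by
    intro y ρ hρ
    rw [Measure.addHaar_ball_of_pos _ _ hρ, finrank_euclideanSpace_fin, mul_comm]
  have hR' : ∀ ρ, 0 < ρ → ρ ≤ R → ρ ^ n ≤ R ^ ((n : ℝ) - α) * ρ ^ α := by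
    intro ρ hρ hρR
    calc ρ ^ n = ρ ^ ((n : ℝ) - α) * ρ ^ α := by
          rw [← Real.rpow_add hρ, ← Real.rpow_natCast]; congr 1; ring
      _ ≤ _ := by
          gcongr
  calc volume U ≤ volume (⋃ i, U ∩ Metric.ball (c i) (r i)) := by
        refine measure_mono fun y hy => ?_
        obtain ⟨i, hi⟩ := mem_iUnion.1 (hcov hy)
        exact mem_iUnion.2 ⟨i, hy, hi⟩
    _ ≤ ∑' i, volume (U ∩ Metric.ball (c i) (r i)) := measure_iUnion_le _
    _ ≤ _ := by
        refine ENNReal.tsum_le_tsum fun i => ?_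
        rw [hK, mul_assoc, ← ENNReal.ofReal_mul (by positivity)]
        have e : R ^ ((n : ℝ) - α) / omegaConst α * (omegaConst α * r i ^ α) =
            R ^ ((n : ℝ) - α) * r i ^ α := by field_simp
        rw [e]
        have hi := hr i
        rcases le_total (r i) R with h | h
        · refine (measure_mono inter_subset_right).trans ?_
          rw [hball _ _ hi]
          gcongr
          exact hR' _ hi h
        · refine (measure_mono (inter_subset_left.trans hU)).trans ?_
          rw [hball _ _ hR]
          gcongr
          refine (hR' R hR le_rfl).trans ?_
          gcongr

/-- Vitali covering estimate: if each `x ∈ S` lies in a ball of radius `R`, with `R` bounded, such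
that `R ^ α ≤ K ν(A)` for some measurable subset `A` of the ball, then the Hausdorff content of `S`
is controlled by `ν`. -/
lemma hausdorffContent_le_of_forall_exists_ball {n : ℕ} {α : ℝ} (hα : 0 < α)
    {S V : Set (EuclideanSpace ℝ (Fin n))} (ν : Measure (EuclideanSpace ℝ (Fin n)))
    (K : ℝ≥0∞) (R₀ : ℝ)
    (h : ∀ x ∈ S, ∃ (z : EuclideanSpace ℝ (Fin n)) (R : ℝ) (A : Set (EuclideanSpace ℝ (Fin n))),
      0 < R ∧ R ≤ R₀ ∧ x ∈ Metric.ball z R ∧ A ⊆ Metric.ball z R ∧ A ⊆ V ∧ MeasurableSet A ∧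
      ENNReal.ofReal (R ^ α) ≤ K * ν A) :
    hausdorffContent α S ≤ ENNReal.ofReal (omegaConst α * 6 ^ α) * (K * ν V) := by
  have hω := omegaConst_pos hα.le
  choose! z R A hR hR₀ hxz hA hAV hAm hbd using h
  obtain ⟨u, huS, hdisj, hcov⟩ := Vitali.exists_disjoint_subfamily_covering_enlargement_closedBall
    S z R R₀ hR₀ 5 (by norm_num)
  have hucount : u.Countable := by
    refine hdisj.countable_of_nonempty_interior fun a ha => ?_
    exact ⟨z a, Metric.ball_subset_interior_closedBall (Metric.mem_ball_self (hR a (huS ha)))⟩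
  have : Countable u := hucount
  calc hausdorffContent α S
      ≤ ∑' a : u, ENNReal.ofReal (omegaConst α * (6 * R a) ^ α) := by
        refine hausdorffContent_le_tsum hα (c := fun a : u => z a) (r := fun a : u => 6 * R a)
          (fun a => by have := hR a (huS a.2); positivity) fun x hx => ?_
        obtain ⟨b, hb, hsub⟩ := hcov x hx
        refine mem_iUnion.2 ⟨⟨b, hb⟩, ?_⟩
        refine Metric.closedBall_subset_ball ?_ (hsub (Metric.ball_subset_closedBall (hxz x hx)))
        have := hR b (huS hb)
        simp only
        linarith
    _ ≤ ∑' a : u, ENNReal.ofReal (omegaConst α * 6 ^ α) * (K * ν (A a)) := by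
        refine ENNReal.tsum_le_tsum fun a => ?_
        rw [Real.mul_rpow (by norm_num) (hR a (huS a.2)).le, ← mul_assoc,
          ENNReal.ofReal_mul (by positivity)]
        gcongr
        exact hbd a (huS a.2)
    _ = ENNReal.ofReal (omegaConst α * 6 ^ α) * (K * ∑' a : u, ν (A a)) := by
        rw [ENNReal.tsum_mul_left, ENNReal.tsum_mul_left]
    _ ≤ _ := by
        gcongr
        refine (tsum_meas_le_meas_iUnion_of_disjoint ν (fun a : u => hAm a (huS a.2)) ?_).trans
          (measure_mono (iUnion_subset fun a => hAV a (huS a.2)))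
        intro a b hab
        have := hdisj a.2 b.2 (fun h => hab (Subtype.ext h))
        exact this.mono ((hA a (huS a.2)).trans Metric.ball_subset_closedBall)
          ((hA b (huS b.2)).trans Metric.ball_subset_closedBall)

/-! ### The energy as a measure -/

/-- The measure on `Ω` whose density at `y` is the inner integral of the improved energy; its total
mass is the improved energy. -/
noncomputable def energyMeasure {n : ℕ} (δ τ : ℝ) (Ω : Set (EuclideanSpace ℝ (Fin n)))
    (u : EuclideanSpace ℝ (Fin n) → ℝ) : Measure (EuclideanSpace ℝ (Fin n)) :=
  (volume.restrict Ω).withDensity fun y =>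
    ∫⁻ x in {x ∈ Ω | dist x y < τ * Metric.infDist y (frontier Ω)},
      ENNReal.ofReal (|u x - u y| / dist x y ^ ((n : ℝ) + δ))

lemma energyMeasure_univ {n : ℕ} (δ τ : ℝ) (Ω : Set (EuclideanSpace ℝ (Fin n)))
    (u : EuclideanSpace ℝ (Fin n) → ℝ) :
    energyMeasure δ τ Ω u univ = improvedEnergy δ τ Ω u := by
  rw [energyMeasure, withDensity_apply _ MeasurableSet.univ, Measure.restrict_univ, improvedEnergy]

lemma ball_infDist_frontier_subset {n : ℕ} {Ω : Set (EuclideanSpace ℝ (Fin n))}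
    {x : EuclideanSpace ℝ (Fin n)} (hx : x ∈ Ω) :
    Metric.ball x (Metric.infDist x (frontier Ω)) ⊆ Ω := by
  intro y hy
  have hnf : ∀ w ∈ Metric.ball x (Metric.infDist x (frontier Ω)), w ∉ frontier Ω := by
    intro w hw hwf
    have h1 := Metric.infDist_le_dist_of_mem (x := x) hwf
    rw [Metric.mem_ball, dist_comm] at hw
    linarith
  have hint : ∀ w ∈ Metric.ball x (Metric.infDist x (frontier Ω)), w ∈ closure Ω →
      w ∈ interior Ω := by
    intro w hw hwc
    by_contra hwi
    exact hnf w hw ⟨hwc, hwi⟩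
  have hpre : IsPreconnected (Metric.ball x (Metric.infDist x (frontier Ω))) :=
    (convex_ball _ _).isPreconnected
  have hxB : x ∈ Metric.ball x (Metric.infDist x (frontier Ω)) :=
    Metric.mem_ball_self (dist_nonneg.trans_lt hy)
  refine interior_subset (hpre.subset_left_of_subset_union isOpen_interior
    (isClosed_closure (s := Ω)).isOpen_compl ?_ ?_ ⟨x, hxB, hint x hxB (subset_closure hx)⟩ hy)
  · exact disjoint_compl_right.mono_left interior_subset_closure
  · intro w hw
    by_cases hwc : w ∈ closure Ω
    · exact Or.inl (hint w hw hwc)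
    · exact Or.inr hwc

lemma lintegral_ball_le_energyMeasure {n : ℕ} {δ τ : ℝ} (hτ : τ ∈ Ioo (0 : ℝ) 1)
    {Ω : Set (EuclideanSpace ℝ (Fin n))} (u : EuclideanSpace ℝ (Fin n) → ℝ)
    {z : EuclideanSpace ℝ (Fin n)} (hz : z ∈ Ω) {r : ℝ}
    (hr : 0 < r) (hrd : r ≤ τ / 4 * Metric.infDist z (frontier Ω)) :
    ∫⁻ x in Metric.ball z r, ∫⁻ y in Metric.ball z r,
        ENNReal.ofReal (|u x - u y| / dist x y ^ ((n : ℝ) + δ)) ≤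
      energyMeasure δ τ Ω u (Metric.ball z r) := by
  obtain ⟨hτ0, hτ1⟩ := hτ
  have hd : 0 < Metric.infDist z (frontier Ω) := by
    by_contra h
    have : Metric.infDist z (frontier Ω) = 0 := le_antisymm (not_lt.1 h) Metric.infDist_nonneg
    rw [this] at hrd; linarith
  have hBΩ : Metric.ball z r ⊆ Ω := by
    refine (Metric.ball_subset_ball ?_).trans (ball_infDist_frontier_subset hz)
    nlinarith
  rw [energyMeasure, withDensity_apply _ measurableSet_ball,
    Measure.restrict_restrict measurableSet_ball, inter_eq_left.2 hBΩ]
  refine setLIntegral_mono' measurableSet_ball fun y hy => ?_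
  have hsub : Metric.ball z r ⊆ {x ∈ Ω | dist x y < τ * Metric.infDist y (frontier Ω)} := by
    intro x hx
    refine ⟨hBΩ hx, ?_⟩
    rw [Metric.mem_ball] at hx hy
    have h1 : dist x y < 2 * r := by
      have := dist_triangle_right x y z
      linarith
    have h2 : Metric.infDist z (frontier Ω) ≤ Metric.infDist y (frontier Ω) + dist z y :=
      Metric.infDist_le_infDist_add_dist
    rw [dist_comm z y] at h2
    -- `d y ≥ d z - r ≥ (4 / τ - 1) r`, so `τ d y ≥ 3 r > |x - y|`
    nlinarith
  refine (lintegral_mono_set hsub).trans (lintegral_mono fun x => ?_)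
  rw [abs_sub_comm, dist_comm]

lemma lintegral_osc_ball_le {n : ℕ} (hn : 1 ≤ n) {δ τ : ℝ} (hδ : δ ∈ Ioo (0 : ℝ) 1)
    (hτ : τ ∈ Ioo (0 : ℝ) 1)
    {Ω : Set (EuclideanSpace ℝ (Fin n))} {u : EuclideanSpace ℝ (Fin n) → ℝ} (hu : Measurable u)
    {z : EuclideanSpace ℝ (Fin n)} (hz : z ∈ Ω) {r : ℝ}
    (hr : 0 < r) (hrd : r ≤ τ / 4 * Metric.infDist z (frontier Ω)) :
    ∫⁻ x in Metric.ball z r, ∫⁻ y in Metric.ball z r, ENNReal.ofReal |u x - u y| ≤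
      ENNReal.ofReal (2 * (1 - δ) * (2 * r) ^ ((n : ℝ) + δ)) *
        energyMeasure δ τ Ω u (Metric.ball z r) := by
  refine (lintegral_osc_le_energy hn hu (convex_ball z r) measurableSet_ball hδ
    (D := 2 * r) (by linarith) fun x hx y hy => ?_).trans ?_
  · rw [Metric.mem_ball] at hx hy
    have := dist_triangle_right x y z
    linarith
  · gcongr
    exact lintegral_ball_le_energyMeasure hτ u hz hr hrd

/-- A ball on which the oscillation of `u` is comparable to the measure of the ball squared carries
energy at least comparable to `r ^ (n - δ) / (1 - δ)`. -/
lemma rpow_le_energyMeasure_of_le_osc {n : ℕ} (hn : 1 ≤ n) {δ τ : ℝ} (hδ : δ ∈ Ioo (0 : ℝ) 1)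
    (hτ : τ ∈ Ioo (0 : ℝ) 1)
    {Ω : Set (EuclideanSpace ℝ (Fin n))} {u : EuclideanSpace ℝ (Fin n) → ℝ} (hu : Measurable u)
    {z : EuclideanSpace ℝ (Fin n)} (hz : z ∈ Ω) {r c : ℝ}
    (hr : 0 < r) (hrd : r ≤ τ / 4 * Metric.infDist z (frontier Ω)) (hc : 0 < c)
    (hosc : ENNReal.ofReal (c * r ^ (2 * n)) ≤
      ∫⁻ x in Metric.ball z r, ∫⁻ y in Metric.ball z r, ENNReal.ofReal |u x - u y|) :
    ENNReal.ofReal (r ^ ((n : ℝ) - δ)) ≤ ENNReal.ofReal (2 ^ (n + 2) / c * (1 - δ)) *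
      energyMeasure δ τ Ω u (Metric.ball z r) := by
  have h := hosc.trans (lintegral_osc_ball_le hn hδ hτ hu hz hr hrd)
  set q : ℝ := (n : ℝ) + δ with hq
  have hcr : 0 < c * r ^ q := by positivity
  have e1 : r ^ ((n : ℝ) - δ) = (c * r ^ q)⁻¹ * (c * r ^ (2 * n)) := by
    have : r ^ (2 * n) = r ^ q * r ^ ((n : ℝ) - δ) := by
      rw [← Real.rpow_add hr, ← Real.rpow_natCast]; congr 1; rw [hq]; push_cast; ring
    rw [this]; field_simp
  rw [e1, ENNReal.ofReal_mul (by positivity)]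
  calc _ ≤ ENNReal.ofReal (c * r ^ q)⁻¹ * (ENNReal.ofReal (2 * (1 - δ) * (2 * r) ^ q) *
        energyMeasure δ τ Ω u (Metric.ball z r)) := by gcongr
    _ ≤ _ := by
      rw [← mul_assoc, ← ENNReal.ofReal_mul (by positivity)]
      refine mul_le_mul' (ENNReal.ofReal_le_ofReal ?_) le_rfl
      rw [Real.mul_rpow (by norm_num) hr.le]
      have h2 : (2 : ℝ) ^ q ≤ 2 ^ (n + 1) := by
        rw [← Real.rpow_natCast]
        refine Real.rpow_le_rpow_of_exponent_le (by norm_num) ?_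
        rw [hq]; push_cast; linarith [hδ.2]
      have h3 : (c * r ^ q)⁻¹ * (2 * (1 - δ) * (2 ^ q * r ^ q)) = 2 * (1 - δ) * 2 ^ q / c := by
        field_simp
      rw [h3]
      have h4 : 0 < 1 - δ := by linarith [hδ.2]
      calc 2 * (1 - δ) * 2 ^ q / c ≤ 2 * (1 - δ) * 2 ^ (n + 1) / c := by gcongr
        _ = _ := by ring

/-! ### Densities of a set in balls -/

/-- The excess of `E` over the half of the ball `B(z, r)`: it is nonnegative iff the density of `E`
in the ball is at least `1 / 2`. -/
noncomputable def halfExcess {n : ℕ} (E : Set (EuclideanSpace ℝ (Fin n)))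
    (z : EuclideanSpace ℝ (Fin n)) (r : ℝ) : ℝ :=
  2 * volume.real (E ∩ Metric.ball z r) - volume.real (Metric.ball z r)

lemma continuous_volume_inter_ball {n : ℕ} (hn : 1 ≤ n) {E : Set (EuclideanSpace ℝ (Fin n))}
    (hE : MeasurableSet E) :
    Continuous fun p : EuclideanSpace ℝ (Fin n) × ℝ => volume.real (E ∩ Metric.ball p.1 p.2) := by
  have : Nonempty (Fin n) := ⟨⟨0, hn⟩⟩
  have hval : ∀ p : EuclideanSpace ℝ (Fin n) × ℝ, volume.real (E ∩ Metric.ball p.1 p.2) =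
      ∫ y, (E ∩ Metric.ball p.1 p.2).indicator (fun _ => (1 : ℝ)) y := fun p => by
    rw [integral_indicator_const _ (hE.inter measurableSet_ball)]; simp
  simp_rw [hval]
  rw [continuous_iff_continuousAt]
  rintro ⟨z, r⟩
  refine continuousAt_of_dominated
    (bound := (Metric.ball z (r + 2)).indicator (fun _ => (1 : ℝ))) ?_ ?_ ?_ ?_
  · exact Eventually.of_forall fun p =>
      (measurable_const.indicator (hE.inter measurableSet_ball)).aestronglyMeasurable
  · have h1 : ∀ᶠ p : EuclideanSpace ℝ (Fin n) × ℝ in 𝓝 (z, r), dist p.1 z < 1 :=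
      (continuous_fst.dist continuous_const).continuousAt.eventually_lt continuousAt_const
        (by simp)
    have h2 : ∀ᶠ p : EuclideanSpace ℝ (Fin n) × ℝ in 𝓝 (z, r), p.2 < r + 1 :=
      continuous_snd.continuousAt.eventually_lt continuousAt_const (by simp)
    filter_upwards [h1, h2] with p hp1 hp2
    refine Eventually.of_forall fun y => ?_
    rw [Real.norm_of_nonneg (indicator_nonneg (fun _ _ => zero_le_one) _)]
    refine indicator_le_indicator_of_subset ?_ (fun _ => zero_le_one) _
    intro w hw
    have hw2 := hw.2
    rw [Metric.mem_ball] at hw2 ⊢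
    have := dist_triangle w p.1 z
    linarith
  · rw [integrable_indicator_iff measurableSet_ball]
    exact integrableOn_const measure_ball_lt_top.ne
  · have hsph : ∀ᵐ y : EuclideanSpace ℝ (Fin n), y ∉ Metric.sphere z r := by
      rw [← measure_eq_zero_iff_ae_notMem]
      exact Measure.addHaar_sphere _ _ _
    filter_upwards [hsph] with y hy
    refine (continuousAt_const (y := (E ∩ Metric.ball z r).indicator (fun _ => (1 : ℝ)) y)).congr ?_
    have hc : Continuous fun p : EuclideanSpace ℝ (Fin n) × ℝ => dist y p.1 := by fun_prop
    rcases lt_or_gt_of_ne (show dist y z ≠ r from hy) with h | h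
    · filter_upwards [hc.continuousAt.eventually_lt continuous_snd.continuousAt
        (show dist y (z, r).1 < (z, r).2 from h)] with p hp
      by_cases hyE : y ∈ E <;> simp [indicator, hyE, h, hp]
    · filter_upwards [continuous_snd.continuousAt.eventually_lt hc.continuousAt
        (show (z, r).2 < dist y (z, r).1 from h)] with p hp
      simp [indicator, h.not_gt, hp.not_gt]

lemma continuous_halfExcess {n : ℕ} (hn : 1 ≤ n) {E : Set (EuclideanSpace ℝ (Fin n))}
    (hE : MeasurableSet E) :
    Continuous fun p : EuclideanSpace ℝ (Fin n) × ℝ => halfExcess E p.1 p.2 := by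
  have h := continuous_volume_inter_ball hn (MeasurableSet.univ (α := EuclideanSpace ℝ (Fin n)))
  simp only [univ_inter] at h
  exact ((continuous_volume_inter_ball hn hE).const_mul 2).sub h

lemma halfExcess_mono {n : ℕ} {E F : Set (EuclideanSpace ℝ (Fin n))} (h : E ⊆ F)
    (z : EuclideanSpace ℝ (Fin n)) (r : ℝ) : halfExcess E z r ≤ halfExcess F z r := by
  unfold halfExcess
  have : volume.real (E ∩ Metric.ball z r) ≤ volume.real (F ∩ Metric.ball z r) :=
    measureReal_mono (inter_subset_inter_left _ h)
      (measure_ne_top_of_subset inter_subset_right measure_ball_lt_top.ne)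
  linarith

lemma halfExcess_compl {n : ℕ} {E : Set (EuclideanSpace ℝ (Fin n))} (hE : MeasurableSet E)
    (z : EuclideanSpace ℝ (Fin n)) (r : ℝ) : halfExcess Eᶜ z r = - halfExcess E z r := by
  unfold halfExcess
  have h := measureReal_inter_add_sdiff (μ := volume) (s := Metric.ball z r) hE
    measure_ball_lt_top.ne
  rw [inter_comm, sdiff_eq, inter_comm _ Eᶜ] at h
  linarith

lemma volume_real_ball {n : ℕ} (z : EuclideanSpace ℝ (Fin n)) {r : ℝ} (hr : 0 < r) :
    volume.real (Metric.ball z r) =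
      volume.real (Metric.ball (0 : EuclideanSpace ℝ (Fin n)) 1) * r ^ n := by
  rw [measureReal_def, Measure.addHaar_ball_of_pos _ _ hr, finrank_euclideanSpace_fin,
    ENNReal.toReal_mul, ENNReal.toReal_ofReal (by positivity), mul_comm, measureReal_def]

lemma volume_real_unitBall_pos (n : ℕ) :
    0 < volume.real (Metric.ball (0 : EuclideanSpace ℝ (Fin n)) 1) :=
  ENNReal.toReal_pos (Metric.measure_ball_pos _ _ one_pos).ne' measure_ball_lt_top.ne

/-- A set of density exactly `1 / 2` in a ball has large oscillation there. -/
lemma le_osc_indicator_of_halfExcess_eq_zero {n : ℕ} {E : Set (EuclideanSpace ℝ (Fin n))}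
    (hE : MeasurableSet E) {z : EuclideanSpace ℝ (Fin n)} {r : ℝ} (hr : 0 < r)
    (h : halfExcess E z r = 0) :
    ENNReal.ofReal (volume.real (Metric.ball (0 : EuclideanSpace ℝ (Fin n)) 1) ^ 2 / 4
        * r ^ (2 * n)) ≤
      ∫⁻ x in Metric.ball z r, ∫⁻ y in Metric.ball z r,
        ENNReal.ofReal |E.indicator (fun _ => (1 : ℝ)) x - E.indicator (fun _ => (1 : ℝ)) y| := by
  have hc := halfExcess_compl hE z r
  rw [h, neg_zero] at hc
  have key : ∀ F : Set (EuclideanSpace ℝ (Fin n)), halfExcess F z r = 0 →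
      volume (F ∩ Metric.ball z r) =
        ENNReal.ofReal (volume.real (Metric.ball (0 : EuclideanSpace ℝ (Fin n)) 1) / 2 * r ^ n) := by
    intro F hF
    rw [halfExcess, volume_real_ball z hr] at hF
    rw [← ENNReal.ofReal_toReal
      (measure_ne_top_of_subset inter_subset_right measure_ball_lt_top.ne :
        volume (F ∩ Metric.ball z r) ≠ ⊤)]
    congr 1
    rw [measureReal_def] at hF
    linarith
  have hv := volume_real_unitBall_pos n
  calc _ = volume (E ∩ Metric.ball z r) * volume (Eᶜ ∩ Metric.ball z r) := by
        rw [key _ h, key _ hc, ← ENNReal.ofReal_mul (by positivity)]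
        congr 1; ring
    _ = ∫⁻ x in E ∩ Metric.ball z r, ∫⁻ y in Eᶜ ∩ Metric.ball z r,
        ENNReal.ofReal |E.indicator (fun _ => (1 : ℝ)) x - E.indicator (fun _ => (1 : ℝ)) y| := by
        rw [mul_comm, ← setLIntegral_const]
        refine setLIntegral_congr_fun (hE.inter measurableSet_ball) fun x hx => ?_
        rw [← one_mul (volume (Eᶜ ∩ Metric.ball z r)), ← setLIntegral_const]
        refine setLIntegral_congr_fun (hE.compl.inter measurableSet_ball) fun y hy => ?_
        have hy1 : y ∉ E := hy.1
        simp [hx.1, hy1]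
    _ ≤ _ := (lintegral_mono_set inter_subset_right).trans
        (lintegral_mono fun x => lintegral_mono_set inter_subset_right)

/-! ### The Boxing inequality for sets -/

/-- The points of `Ω` around which `E` fills at least half of some ball that is small compared to
the distance to the boundary. -/
def halfDensitySet {n : ℕ} (τ : ℝ) (Ω E : Set (EuclideanSpace ℝ (Fin n))) :
    Set (EuclideanSpace ℝ (Fin n)) :=
  {x ∈ Ω | ∃ r : ℝ, 0 < r ∧ r ≤ τ / 4 * Metric.infDist x (frontier Ω) ∧ 0 ≤ halfExcess E x r}

/-- If `E` fills at least half of a small ball around `x` and at most half of the central ball, then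
by continuity it fills exactly half of a ball around some point of the curve joining `x` to the
center. -/
lemma exists_halfExcess_eq_zero {n : ℕ} (hn : 1 ≤ n) {τ s CJ : ℝ} (hτ : 0 < τ) (hs : 1 ≤ s)
    (hCJ : 0 < CJ)
    {Ω : Set (EuclideanSpace ℝ (Fin n))} (hΩd : ∀ x ∈ Ω, 0 < Metric.infDist x (frontier Ω))
    {x xJ : EuclideanSpace ℝ (Fin n)} {γ : ℝ → EuclideanSpace ℝ (Fin n)}
    (hγ : ContinuousOn γ (Icc 0 1)) (hγΩ : MapsTo γ (Icc 0 1) Ω) (hγ0 : γ 0 = x) (hγ1 : γ 1 = xJ)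
    (hJ : ∀ t ∈ Icc (0 : ℝ) 1, dist (γ t) x ^ s < CJ * Metric.infDist (γ t) (frontier Ω))
    {E : Set (EuclideanSpace ℝ (Fin n))} (hE : MeasurableSet E)
    (hcenter : halfExcess E xJ (τ / 4 * Metric.infDist xJ (frontier Ω)) ≤ 0)
    {r₀ : ℝ} (hr₀ : 0 < r₀) (hr₀d : r₀ ≤ τ / 4 * Metric.infDist x (frontier Ω))
    (hx : 0 ≤ halfExcess E x r₀) :
    ∃ z ∈ Ω, ∃ r : ℝ, 0 < r ∧ r ≤ τ / 4 * Metric.infDist z (frontier Ω) ∧ halfExcess E z r = 0 ∧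
      dist z x ^ s < 4 * CJ / τ * r := by
  have hcont := continuous_halfExcess hn hE
  have hxΩ : x ∈ Ω := hγ0 ▸ hγΩ (by simp : (0 : ℝ) ∈ Icc (0 : ℝ) 1)
  rcases le_total (halfExcess E x (τ / 4 * Metric.infDist x (frontier Ω))) 0 with h | h
  · have hc : ContinuousOn (fun r => halfExcess E x r)
        (Icc r₀ (τ / 4 * Metric.infDist x (frontier Ω))) :=
      (hcont.comp (Continuous.prodMk_right x)).continuousOn
    obtain ⟨r, hr, hr0⟩ := intermediate_value_Icc' hr₀d hc ⟨h, hx⟩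
    refine ⟨x, hxΩ, r, hr₀.trans_le hr.1, hr.2, hr0, ?_⟩
    rw [dist_self, Real.zero_rpow (by linarith)]
    have : 0 < r := hr₀.trans_le hr.1
    positivity
  · have hc : ContinuousOn
        (fun t => halfExcess E (γ t) (τ / 4 * Metric.infDist (γ t) (frontier Ω))) (Icc 0 1) :=
      hcont.comp_continuousOn (f := fun t => (γ t, τ / 4 * Metric.infDist (γ t) (frontier Ω))) (hγ.prodMk
        (continuousOn_const.mul ((Metric.continuous_infDist_pt _).comp_continuousOn hγ)))
    obtain ⟨t, ht, ht0⟩ := intermediate_value_Icc' (zero_le_one' ℝ) hc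
      (show (0 : ℝ) ∈ _ by simp only [hγ0, hγ1]; exact ⟨hcenter, h⟩)
    refine ⟨γ t, hγΩ ht, τ / 4 * Metric.infDist (γ t) (frontier Ω), ?_, le_rfl, ht0, ?_⟩
    · have := hΩd _ (hγΩ ht)
      positivity
    · refine (hJ t ht).trans_eq ?_
      field_simp

/-- Boxing inequality for sets: the points around which `E` fills at least half of some small ball
have Hausdorff content controlled by the fractional perimeter of `E`, provided that `E` fills at
most half of the central ball. -/
lemma hausdorffContent_le_energy_indicator {n : ℕ} (hn : 1 ≤ n) {δ τ s CJ D : ℝ}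
    (hδ : δ ∈ Ioo (0 : ℝ) 1) (hτ : τ ∈ Ioo (0 : ℝ) 1) (hs : 1 ≤ s) (hCJ : 0 < CJ) (hD : 0 < D)
    {Ω : Set (EuclideanSpace ℝ (Fin n))} (hΩd : ∀ x ∈ Ω, 0 < Metric.infDist x (frontier Ω))
    (hΩD : ∀ x ∈ Ω, Metric.infDist x (frontier Ω) ≤ D)
    {xJ : EuclideanSpace ℝ (Fin n)}
    (hJ : ∀ x ∈ Ω, ∃ γ : ℝ → EuclideanSpace ℝ (Fin n),
      ContinuousOn γ (Icc 0 1) ∧ MapsTo γ (Icc 0 1) Ω ∧ γ 0 = x ∧ γ 1 = xJ ∧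
      ∀ t ∈ Icc (0 : ℝ) 1, dist (γ t) x ^ s < CJ * Metric.infDist (γ t) (frontier Ω))
    {E : Set (EuclideanSpace ℝ (Fin n))} (hE : MeasurableSet E)
    (hcenter : halfExcess E xJ (τ / 4 * Metric.infDist xJ (frontier Ω)) ≤ 0) :
    hausdorffContent (s * ((n : ℝ) - δ)) (halfDensitySet τ Ω E) ≤
      ENNReal.ofReal (omegaConst (s * ((n : ℝ) - δ)) * 6 ^ (s * ((n : ℝ) - δ))) *
        (ENNReal.ofReal ((4 * CJ / τ + D ^ (s - 1)) ^ ((n : ℝ) - δ) *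
          (2 ^ (n + 2) / (volume.real (Metric.ball (0 : EuclideanSpace ℝ (Fin n)) 1) ^ 2 / 4)
            * (1 - δ))) *
        improvedEnergy δ τ Ω (E.indicator fun _ => 1)) := by
  set v := volume.real (Metric.ball (0 : EuclideanSpace ℝ (Fin n)) 1) with hv
  have hv0 : 0 < v := volume_real_unitBall_pos n
  have hn' : (1 : ℝ) ≤ n := by exact_mod_cast hn
  have hδn : 0 < (n : ℝ) - δ := by linarith [hδ.2]
  have hτ0 := hτ.1
  set M := 4 * CJ / τ + D ^ (s - 1) with hM
  have hM0 : 0 < M := by positivity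
  rw [← energyMeasure_univ]
  refine hausdorffContent_le_of_forall_exists_ball (by positivity) _ _ ((M * D) ^ s⁻¹)
    fun x hx => ?_
  obtain ⟨hxΩ, r₀, hr₀, hr₀d, hr₀x⟩ := hx
  obtain ⟨γ, hγ, hγΩ, hγ0, hγ1, hγJ⟩ := hJ x hxΩ
  obtain ⟨z, hz, r, hr, hrd, hr0, hzx⟩ := exists_halfExcess_eq_zero hn hτ.1 hs hCJ hΩd hγ hγΩ hγ0
    hγ1 hγJ hE hcenter hr₀ hr₀d hr₀x
  have hrD : r ≤ D := by
    have h1 := hΩD z hz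
    have h2 := hΩd z hz
    nlinarith [hτ.2]
  have hs0 : 0 < s := by linarith
  have hMr : 0 < M * r := by positivity
  refine ⟨z, (M * r) ^ s⁻¹, Metric.ball z r, by positivity, ?_, ?_, ?_, subset_univ _,
    measurableSet_ball, ?_⟩
  · gcongr
  · rw [Metric.mem_ball, dist_comm, Real.lt_rpow_inv_iff_of_pos dist_nonneg hMr.le hs0]
    refine hzx.trans_le ?_
    gcongr
    rw [hM]
    have : 0 ≤ D ^ (s - 1) := by positivity
    linarith
  · refine Metric.ball_subset_ball ?_
    rw [Real.le_rpow_inv_iff_of_pos hr.le hMr.le hs0]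
    calc r ^ s = r ^ (s - 1) * r := by
          rw [← Real.rpow_add_one hr.ne']; congr 1; ring
      _ ≤ D ^ (s - 1) * r := by
          gcongr
      _ ≤ M * r := by
          gcongr
          rw [hM]
          have : 0 ≤ 4 * CJ / τ := by positivity
          linarith
  · rw [← Real.rpow_mul hMr.le, inv_mul_cancel_left₀ hs0.ne', Real.mul_rpow hM0.le hr.le,
      ENNReal.ofReal_mul (by positivity), ENNReal.ofReal_mul (by positivity), mul_assoc]
    gcongr
    exact rpow_le_energyMeasure_of_le_osc hn hδ hτ (measurable_const.indicator hE) hz hr hrd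
      (by positivity) (le_osc_indicator_of_halfExcess_eq_zero hE hr hr0)

/-! ### The coarea formula for the improved energy -/

lemma improvedEnergy_congr_ae {n : ℕ} (δ τ : ℝ) {Ω : Set (EuclideanSpace ℝ (Fin n))}
    {u w : EuclideanSpace ℝ (Fin n) → ℝ} (h : u =ᵐ[volume.restrict Ω] w) :
    improvedEnergy δ τ Ω u = improvedEnergy δ τ Ω w := by
  refine lintegral_congr_ae ?_
  filter_upwards [h] with y hy
  refine lintegral_congr_ae ?_
  filter_upwards [ae_mono (Measure.restrict_mono (sep_subset _ _) le_rfl) h] with x hx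
  rw [hx, hy]

lemma improvedEnergy_neg {n : ℕ} (δ τ : ℝ) (Ω : Set (EuclideanSpace ℝ (Fin n)))
    (u : EuclideanSpace ℝ (Fin n) → ℝ) :
    improvedEnergy δ τ Ω (fun x => - u x) = improvedEnergy δ τ Ω u := by
  unfold improvedEnergy
  simp_rw [neg_sub_neg, abs_sub_comm]

/-- The fractional perimeter of the superlevel set `{u > t}`. -/
noncomputable def levelEnergy {n : ℕ} (δ τ : ℝ) (Ω : Set (EuclideanSpace ℝ (Fin n)))
    (u : EuclideanSpace ℝ (Fin n) → ℝ) (t : ℝ) : ℝ≥0∞ :=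
  improvedEnergy δ τ Ω ({x | t < u x}.indicator fun _ => 1)

lemma exists_kernel_improvedEnergy {n : ℕ} (δ τ : ℝ) {Ω : Set (EuclideanSpace ℝ (Fin n))}
    (hΩ : MeasurableSet Ω) :
    ∃ K : EuclideanSpace ℝ (Fin n) × EuclideanSpace ℝ (Fin n) → ℝ≥0∞, Measurable K ∧
      ∀ u : EuclideanSpace ℝ (Fin n) → ℝ,
        improvedEnergy δ τ Ω u = ∫⁻ y, ∫⁻ x, K (y, x) * ENNReal.ofReal |u x - u y| := by
  let W : Set (EuclideanSpace ℝ (Fin n) × EuclideanSpace ℝ (Fin n)) :=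
    {q | q.1 ∈ Ω ∧ q.2 ∈ Ω ∧ dist q.2 q.1 < τ * Metric.infDist q.1 (frontier Ω)}
  have hW : MeasurableSet W := by
    have hlt : MeasurableSet {q : EuclideanSpace ℝ (Fin n) × EuclideanSpace ℝ (Fin n) |
        dist q.2 q.1 < τ * Metric.infDist q.1 (frontier Ω)} := by
      refine measurableSet_lt ?_ ?_
      · exact (continuous_snd.dist continuous_fst).measurable
      · exact (((Metric.continuous_infDist_pt _).comp continuous_fst).measurable).const_mul _
    exact (measurable_fst hΩ).inter ((measurable_snd hΩ).inter hlt)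
  have hdist : Measurable fun q : EuclideanSpace ℝ (Fin n) × EuclideanSpace ℝ (Fin n) =>
      ENNReal.ofReal (1 / dist q.2 q.1 ^ ((n : ℝ) + δ)) :=
    ((((continuous_snd.dist continuous_fst).measurable).pow_const _).const_div 1).ennreal_ofReal
  refine ⟨W.indicator fun q => ENNReal.ofReal (1 / dist q.2 q.1 ^ ((n : ℝ) + δ)),
    hdist.indicator hW, fun u => ?_⟩
  rw [improvedEnergy, ← lintegral_indicator hΩ]
  refine lintegral_congr fun y => ?_
  by_cases hy : y ∈ Ω
  · have hm : MeasurableSet {x ∈ Ω | dist x y < τ * Metric.infDist y (frontier Ω)} :=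
      hΩ.inter (measurableSet_lt (f := fun x => dist x y) (by fun_prop) measurable_const)
    rw [indicator_of_mem hy, ← lintegral_indicator hm]
    refine lintegral_congr fun x => ?_
    by_cases hx : x ∈ {x ∈ Ω | dist x y < τ * Metric.infDist y (frontier Ω)}
    · rw [indicator_of_mem hx, indicator_of_mem (show (y, x) ∈ W from ⟨hy, hx.1, hx.2⟩),
        ← ENNReal.ofReal_mul (by positivity)]
      congr 1; ring
    · rw [indicator_of_notMem hx, indicator_of_notMem (fun h : (y, x) ∈ W => hx ⟨h.2.1, h.2.2⟩),
        zero_mul]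
  · rw [indicator_of_notMem hy]
    have : ∀ x, (y, x) ∉ W := fun x h => hy h.1
    simp [this]

lemma lintegral_abs_indicator_sub (a b : ℝ) :
    ∫⁻ t, ENNReal.ofReal |(if t < a then (1 : ℝ) else 0) - (if t < b then 1 else 0)| =
      ENNReal.ofReal |a - b| := by
  wlog hab : b ≤ a generalizing a b with H
  · rw [abs_sub_comm a, ← H b a (le_of_not_ge hab)]
    simp_rw [abs_sub_comm]
  have h1 : ∀ t : ℝ, ENNReal.ofReal |(if t < a then (1 : ℝ) else 0) - (if t < b then 1 else 0)| =
      (Ico b a).indicator (fun _ => 1) t := by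
    intro t
    by_cases h2 : t < b
    · have h3 : t < a := h2.trans_le hab
      simp [h2, h3]
    · by_cases h3 : t < a
      · simp [h2, h3, not_lt.1 h2]
      · simp [h2, h3]
  simp_rw [h1]
  rw [lintegral_indicator_const measurableSet_Ico, Real.volume_Ico, one_mul,
    abs_of_nonneg (sub_nonneg.2 hab)]

/-- Coarea formula: the improved energy of `u` is the integral over `t` of the fractional perimeters of
the sets `{u > t}`, because `|a - b|` is the measure of the levels separating `a` and `b`. -/
lemma measurable_levelEnergy_and_coarea {n : ℕ} (δ τ : ℝ) {Ω : Set (EuclideanSpace ℝ (Fin n))}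
    (hΩ : MeasurableSet Ω) {u : EuclideanSpace ℝ (Fin n) → ℝ} (hu : Measurable u) :
    Measurable (levelEnergy δ τ Ω u) ∧
      improvedEnergy δ τ Ω u = ∫⁻ t, levelEnergy δ τ Ω u t := by
  obtain ⟨K, hK, hKe⟩ := exists_kernel_improvedEnergy δ τ hΩ
  have hlev : ∀ t, levelEnergy δ τ Ω u t = ∫⁻ y, ∫⁻ x, K (y, x) *
      ENNReal.ofReal |(if t < u x then (1 : ℝ) else 0) - (if t < u y then 1 else 0)| := by
    intro t
    rw [levelEnergy, hKe]
    rfl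
  -- the integrand as a function of `((t, y), x)`
  have hmeas : Measurable fun q : (ℝ × EuclideanSpace ℝ (Fin n)) × EuclideanSpace ℝ (Fin n) =>
      K (q.1.2, q.2) * ENNReal.ofReal
        |(if q.1.1 < u q.2 then (1 : ℝ) else 0) - (if q.1.1 < u q.1.2 then 1 else 0)| := by
    refine Measurable.mul (hK.comp (by fun_prop)) (Measurable.ennreal_ofReal ?_)
    refine (Measurable.sub ?_ ?_).abs
    · exact Measurable.ite (measurableSet_lt (by fun_prop) (by fun_prop)) measurable_const
        measurable_const
    · exact Measurable.ite (measurableSet_lt (by fun_prop) (by fun_prop)) measurable_const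
        measurable_const
  have hmeas2 : Measurable fun p : ℝ × EuclideanSpace ℝ (Fin n) => ∫⁻ x, K (p.2, x) *
      ENNReal.ofReal |(if p.1 < u x then (1 : ℝ) else 0) - (if p.1 < u p.2 then 1 else 0)| :=
    hmeas.lintegral_prod_right'
  refine ⟨?_, ?_⟩
  · have : levelEnergy δ τ Ω u = fun t => ∫⁻ y, ∫⁻ x, K (y, x) *
        ENNReal.ofReal |(if t < u x then (1 : ℝ) else 0) - (if t < u y then 1 else 0)| :=
      funext hlev
    rw [this]
    exact hmeas2.lintegral_prod_right'
  · simp_rw [hlev]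
    rw [lintegral_lintegral_swap hmeas2.aemeasurable, hKe]
    refine lintegral_congr fun y => ?_
    have hm3 : Measurable fun p : ℝ × EuclideanSpace ℝ (Fin n) => K (y, p.2) *
        ENNReal.ofReal |(if p.1 < u p.2 then (1 : ℝ) else 0) - (if p.1 < u y then 1 else 0)| :=
      hmeas.comp ((measurable_fst.prodMk measurable_const).prodMk measurable_snd)
    rw [lintegral_lintegral_swap hm3.aemeasurable]
    refine lintegral_congr fun x => ?_
    rw [lintegral_const_mul, lintegral_abs_indicator_sub]
    refine Measurable.ennreal_ofReal (Measurable.sub ?_ ?_).abs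
    · exact Measurable.ite measurableSet_Iio measurable_const measurable_const
    · exact Measurable.ite measurableSet_Iio measurable_const measurable_const

/-! ### Exceptional sets of the Lebesgue differentiation -/

lemma lintegral_osc_le_two_mul {n : ℕ} {u : EuclideanSpace ℝ (Fin n) → ℝ} (hu : Measurable u)
    (a : ℝ) (B : Set (EuclideanSpace ℝ (Fin n))) :
    ∫⁻ x in B, ∫⁻ y in B, ENNReal.ofReal |u x - u y| ≤
      2 * volume B * ∫⁻ x in B, ENNReal.ofReal |u x - a| := by
  have hm : Measurable fun x => ENNReal.ofReal |u x - a| := by fun_prop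
  calc _ ≤ ∫⁻ x in B, ∫⁻ y in B, (ENNReal.ofReal |u x - a| + ENNReal.ofReal |u y - a|) := by
        refine lintegral_mono fun x => lintegral_mono fun y => ?_
        rw [← ENNReal.ofReal_add (abs_nonneg _) (abs_nonneg _)]
        refine ENNReal.ofReal_le_ofReal ?_
        rw [abs_sub_comm (u y)]
        exact abs_sub_le _ _ _
    _ = ∫⁻ x in B, (ENNReal.ofReal |u x - a| * volume B + ∫⁻ y in B, ENNReal.ofReal |u y - a|) := by
        refine lintegral_congr fun x => ?_
        rw [lintegral_add_left measurable_const, lintegral_const, Measure.restrict_apply_univ]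
    _ = _ := by
        rw [lintegral_add_right _ measurable_const, lintegral_mul_const _ hm, lintegral_const,
          Measure.restrict_apply_univ]
        ring

/-- At almost every point, the oscillation of a locally integrable function in small balls is small
compared to the square of the measure of the ball. -/
lemma ae_eventually_osc_lt {n : ℕ} (hn : 1 ≤ n) {u : EuclideanSpace ℝ (Fin n) → ℝ}
    (hu : Measurable u) (hui : LocallyIntegrable u) {c : ℝ} (hc : 0 < c) :
    ∀ᵐ x : EuclideanSpace ℝ (Fin n), ∀ᶠ r in 𝓝[>] (0 : ℝ),
      ∫⁻ y in Metric.ball x r, ∫⁻ w in Metric.ball x r, ENNReal.ofReal |u y - u w| <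
        ENNReal.ofReal (c * r ^ (2 * n)) := by
  have : Nonempty (Fin n) := ⟨⟨0, hn⟩⟩
  set v := volume.real (Metric.ball (0 : EuclideanSpace ℝ (Fin n)) 1) with hv
  have hv0 : 0 < v := volume_real_unitBall_pos n
  filter_upwards [IsUnifLocDoublingMeasure.ae_tendsto_average_norm_sub volume hui 1] with x hx
  have h1 := hx (l := 𝓝[>] (0 : ℝ)) (fun _ => x) id tendsto_id (by
    filter_upwards [self_mem_nhdsWithin] with r hr
    exact Metric.mem_closedBall_self (by simpa using (le_of_lt hr : (0 : ℝ) ≤ r)))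
  have h2 : ∀ᶠ r in 𝓝[>] (0 : ℝ), ⨍ y in Metric.closedBall x r, ‖u y - u x‖ < c / (2 * v ^ 2) :=
    h1.eventually_lt_const (by positivity)
  filter_upwards [h2, self_mem_nhdsWithin] with r hr hr0
  have hr0 : 0 < r := hr0
  have hvol : volume.real (Metric.closedBall x r) = v * r ^ n := by
    rw [measureReal_def, Measure.addHaar_closedBall_eq_addHaar_ball, ← measureReal_def,
      volume_real_ball x hr0]
  have hint : IntegrableOn (fun y => u y - u x) (Metric.closedBall x r) :=
    (hui.integrableOn_isCompact (isCompact_closedBall x r)).sub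
      (integrableOn_const measure_closedBall_lt_top.ne)
  have hI : ∫ y in Metric.closedBall x r, ‖u y - u x‖ < c / (2 * v ^ 2) * (v * r ^ n) := by
    rw [setAverage_eq, hvol, smul_eq_mul, inv_mul_lt_iff₀ (by positivity)] at hr
    linarith
  calc _ ≤ 2 * volume (Metric.ball x r) * ∫⁻ y in Metric.ball x r, ENNReal.ofReal |u y - u x| :=
        lintegral_osc_le_two_mul hu _ _
    _ ≤ ENNReal.ofReal (2 * (v * r ^ n)) *
          ENNReal.ofReal (∫ y in Metric.closedBall x r, ‖u y - u x‖) := by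
        gcongr
        · rw [ENNReal.ofReal_mul (by norm_num), ← volume_real_ball x hr0, measureReal_def,
            ENNReal.ofReal_toReal measure_ball_lt_top.ne]
          simp
        · rw [ofReal_integral_eq_lintegral_ofReal hint.norm
            (Eventually.of_forall fun _ => norm_nonneg _)]
          exact lintegral_mono_set Metric.ball_subset_closedBall
    _ = ENNReal.ofReal (2 * (v * r ^ n) * ∫ y in Metric.closedBall x r, ‖u y - u x‖) := by
        rw [← ENNReal.ofReal_mul (by positivity)]
    _ < _ := by
        rw [ENNReal.ofReal_lt_ofReal_iff (by positivity)]
        calc _ < 2 * (v * r ^ n) * (c / (2 * v ^ 2) * (v * r ^ n)) := by gcongr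
          _ = _ := by rw [pow_mul']; field_simp

/-- The set where the oscillation of `u` in arbitrarily small balls is not small has vanishing
Hausdorff content: it is Lebesgue null, hence null for the energy measure, and a Vitali covering by
balls in a neighbourhood of small energy applies. -/
lemma hausdorffContent_frequently_osc_eq_zero {n : ℕ} (hn : 1 ≤ n) {δ τ α : ℝ}
    (hδ : δ ∈ Ioo (0 : ℝ) 1) (hτ : τ ∈ Ioo (0 : ℝ) 1) (hα : (n : ℝ) - δ ≤ α)
    {Ω : Set (EuclideanSpace ℝ (Fin n))}
    (hΩd : ∀ x ∈ Ω, 0 < Metric.infDist x (frontier Ω))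
    {u : EuclideanSpace ℝ (Fin n) → ℝ} (hu : Measurable u) (hui : LocallyIntegrable u)
    (hfin : improvedEnergy δ τ Ω u ≠ ⊤) {c : ℝ} (hc : 0 < c) :
    hausdorffContent α {x ∈ Ω | ∃ᶠ r in 𝓝[>] (0 : ℝ), ENNReal.ofReal (c * r ^ (2 * n)) ≤
      ∫⁻ y in Metric.ball x r, ∫⁻ w in Metric.ball x r, ENNReal.ofReal |u y - u w|} = 0 := by
  have hn' : (1 : ℝ) ≤ n := by exact_mod_cast hn
  have hα0 : 0 < α := by linarith [hδ.2]
  set S := {x ∈ Ω | ∃ᶠ r in 𝓝[>] (0 : ℝ), ENNReal.ofReal (c * r ^ (2 * n)) ≤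
      ∫⁻ y in Metric.ball x r, ∫⁻ w in Metric.ball x r, ENNReal.ofReal |u y - u w|} with hS
  set ν := energyMeasure δ τ Ω u with hν
  have hνfin : IsFiniteMeasure ν := ⟨by
    rw [hν, energyMeasure_univ]; exact lt_top_iff_ne_top.2 hfin⟩
  have hvol : volume S = 0 := by
    refine measure_mono_null ?_ (ae_eventually_osc_lt hn hu hui hc)
    intro x hx hx'
    refine hx.2 ?_
    filter_upwards [hx'] with r hr
    exact not_le.2 hr
  have hac : ν ≪ volume :=
    (withDensity_absolutelyContinuous _ _).trans Measure.absolutelyContinuous_restrict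
  have hνS : ν S = 0 := hac hvol
  set L : ℝ≥0∞ := ENNReal.ofReal (omegaConst α * 6 ^ α) *
    ENNReal.ofReal (2 ^ (n + 2) / c * (1 - δ)) with hL
  have hLt : L ≠ ⊤ := ENNReal.mul_ne_top ENNReal.ofReal_ne_top ENNReal.ofReal_ne_top
  have hdiv : hausdorffContent α S / L ≤ ν S := by
    rw [S.measure_eq_iInf_isOpen ν]
    refine le_iInf fun V => le_iInf fun hSV => le_iInf fun hV => ?_
    refine ENNReal.div_le_of_le_mul' ?_
    rw [hL, mul_assoc]
    refine hausdorffContent_le_of_forall_exists_ball hα0 ν _ 1 fun x hx => ?_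
    have h1 : ∀ᶠ r in 𝓝[>] (0 : ℝ), r ≤ τ / 4 * Metric.infDist x (frontier Ω) := by
      refine mem_nhdsWithin_of_mem_nhds (Iic_mem_nhds ?_)
      have := hΩd x hx.1
      have := hτ.1
      positivity
    have h2 : ∀ᶠ r in 𝓝[>] (0 : ℝ), r ≤ 1 := mem_nhdsWithin_of_mem_nhds (Iic_mem_nhds one_pos)
    have h3 : ∀ᶠ r in 𝓝[>] (0 : ℝ), Metric.ball x r ⊆ V := by
      obtain ⟨ε, hε, hεV⟩ := Metric.isOpen_iff.1 hV x (hSV hx)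
      filter_upwards [mem_nhdsWithin_of_mem_nhds (Iic_mem_nhds hε)] with r hr
      exact (Metric.ball_subset_ball hr).trans hεV
    obtain ⟨r, hrosc, hrd, hr1, hrV, hr0⟩ := (hx.2.and_eventually
      (h1.and (h2.and (h3.and self_mem_nhdsWithin)))).exists
    have hr0 : 0 < r := hr0
    refine ⟨x, r, Metric.ball x r, hr0, hr1, Metric.mem_ball_self hr0, Subset.rfl, hrV,
      measurableSet_ball, ?_⟩
    refine (ENNReal.ofReal_le_ofReal ?_).trans
      (rpow_le_energyMeasure_of_le_osc hn hδ hτ hu hx.1 hr0 hrd hc hrosc)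
    exact Real.rpow_le_rpow_of_exponent_ge hr0 hr1 hα
  rw [hνS, nonpos_iff_eq_zero, ENNReal.div_eq_zero_iff] at hdiv
  exact hdiv.resolve_right hLt

/-! ### Lebesgue points and superlevel sets -/

lemma eventually_halfExcess_pos_or_neg {n : ℕ} (hn : 1 ≤ n) {E : Set (EuclideanSpace ℝ (Fin n))}
    (hE : MeasurableSet E) {x : EuclideanSpace ℝ (Fin n)}
    (h : ∀ᶠ r in 𝓝[>] (0 : ℝ), halfExcess E x r ≠ 0) :
    (∀ᶠ r in 𝓝[>] (0 : ℝ), 0 < halfExcess E x r) ∨ ∀ᶠ r in 𝓝[>] (0 : ℝ), halfExcess E x r < 0 := by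
  obtain ⟨r₀, hr₀, hne⟩ := mem_nhdsGT_iff_exists_Ioo_subset.1 h
  have hmem : Ioo (0 : ℝ) r₀ ∈ 𝓝[>] (0 : ℝ) := Ioo_mem_nhdsGT hr₀
  by_contra! hcon
  obtain ⟨h1, h2⟩ := hcon
  obtain ⟨r₁, hr₁, hm₁⟩ := (h1.and_eventually hmem).exists
  obtain ⟨r₂, hr₂, hm₂⟩ := (h2.and_eventually hmem).exists
  have hc : ContinuousOn (fun r => halfExcess E x r) (Ioo 0 r₀) :=
    ((continuous_halfExcess hn hE).comp (Continuous.prodMk_right x)).continuousOn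
  obtain ⟨r, hr, hr0⟩ := isPreconnected_Ioo.intermediate_value hm₁ hm₂ hc
    ⟨hr₁, hr₂⟩
  exact hne hr hr0

/-- Near a Lebesgue point with value `a > t`, the set `{u > t}` fills more than half of each small
ball. -/
lemma HasLebesgueValue.eventually_halfExcess_pos {n : ℕ} {u : EuclideanSpace ℝ (Fin n) → ℝ}
    (hu : Measurable u) (hui : LocallyIntegrable u) {x : EuclideanSpace ℝ (Fin n)} {a t : ℝ}
    (ha : HasLebesgueValue u x a) (hta : t < a) :
    ∀ᶠ r in 𝓝[>] (0 : ℝ), 0 < halfExcess {y | t < u y} x r := by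
  have hat : 0 < a - t := sub_pos.2 hta
  filter_upwards [ha.eventually_lt_const (show 0 < (a - t) / 2 by linarith), self_mem_nhdsWithin]
    with r hr hr0
  have hr0 : 0 < r := hr0
  have hint : IntegrableOn (fun y => |u y - a|) (Metric.ball x r) :=
    (((hui.integrableOn_isCompact (isCompact_closedBall x r)).mono_set
      Metric.ball_subset_closedBall).sub (integrableOn_const measure_ball_lt_top.ne)).abs
  have hcheb := mul_meas_ge_le_integral_of_nonneg
    (Eventually.of_forall fun y => abs_nonneg (u y - a)) hint (a - t)
  have hvpos : 0 < volume.real (Metric.ball x r) :=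
    ENNReal.toReal_pos (Metric.measure_ball_pos _ _ hr0).ne' measure_ball_lt_top.ne
  have hE : MeasurableSet {y | t < u y} := measurableSet_lt measurable_const hu
  have hsub : volume.real ({y | t < u y}ᶜ ∩ Metric.ball x r) ≤
      (volume.restrict (Metric.ball x r)).real {y | a - t ≤ |u y - a|} := by
    rw [← measureReal_restrict_apply hE.compl]
    refine measureReal_mono ?_ (measure_ne_top_of_subset (subset_univ _)
      (by rw [Measure.restrict_apply_univ]; exact measure_ball_lt_top.ne))
    intro y hy
    have hy' : u y ≤ t := not_lt.1 hy
    show a - t ≤ |u y - a|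
    rw [abs_sub_comm]
    exact (by linarith : a - t ≤ a - u y).trans (le_abs_self _)
  rw [setAverage_eq, smul_eq_mul, inv_mul_lt_iff₀ hvpos] at hr
  have h1 : (a - t) * volume.real ({y | t < u y}ᶜ ∩ Metric.ball x r) <
      (a - t) * (volume.real (Metric.ball x r) / 2) := by
    calc _ ≤ (a - t) * _ := by gcongr
      _ ≤ _ := hcheb
      _ < _ := by linarith
  have h2 := lt_of_mul_lt_mul_left h1 hat.le
  have h3 := halfExcess_compl hE x r
  rw [halfExcess] at h3
  linarith

/-- If `{u > t₁}` fills at least half and `{u > t₂}` at most half of the ball, then the mean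
distance of `u` to a value in `[t₁, t₂]` is controlled by the oscillation and `t₂ - t₁`. -/
lemma volume_mul_lintegral_abs_sub_le {n : ℕ} {u : EuclideanSpace ℝ (Fin n) → ℝ}
    (hu : Measurable u) {x : EuclideanSpace ℝ (Fin n)} {r a t₁ t₂ : ℝ}
    (h₁ : 0 ≤ halfExcess {y | t₁ < u y} x r) (h₂ : halfExcess {y | t₂ < u y} x r ≤ 0)
    (ha₁ : t₁ ≤ a) (ha₂ : a ≤ t₂) :
    volume (Metric.ball x r) * ∫⁻ y in Metric.ball x r, ENNReal.ofReal |u y - a| ≤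
      4 * (∫⁻ y in Metric.ball x r, ∫⁻ w in Metric.ball x r, ENNReal.ofReal |u y - u w|) +
        ENNReal.ofReal (t₂ - t₁) * volume (Metric.ball x r) ^ 2 := by
  set B := Metric.ball x r with hB
  have hBt : volume B ≠ ⊤ := measure_ball_lt_top.ne
  have hE : ∀ t, MeasurableSet {y | t < u y} := fun t => measurableSet_lt measurable_const hu
  -- a set filling half of the ball bounds the integral of the oscillation from below
  have half : ∀ F : Set (EuclideanSpace ℝ (Fin n)), MeasurableSet F → 0 ≤ halfExcess F x r →
      ∀ g : EuclideanSpace ℝ (Fin n) → ℝ, Measurable g → (∀ y, ∀ w ∈ F, g y ≤ |u y - u w|) →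
      volume B * ∫⁻ y in B, ENNReal.ofReal (g y) ≤
        2 * ∫⁻ y in B, ∫⁻ w in B, ENNReal.ofReal |u y - u w| := by
    intro F hF hFx g hg hgF
    have hvol : volume B ≤ 2 * volume (F ∩ B) := by
      rw [halfExcess, ← hB] at hFx
      have hFt : volume (F ∩ B) ≠ ⊤ := measure_ne_top_of_subset inter_subset_right hBt
      rw [← ENNReal.toReal_le_toReal hBt (ENNReal.mul_ne_top (by simp) hFt), ENNReal.toReal_mul]
      simp only [measureReal_def] at hFx
      simpa using hFx
    calc volume B * ∫⁻ y in B, ENNReal.ofReal (g y)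
        ≤ 2 * volume (F ∩ B) * ∫⁻ y in B, ENNReal.ofReal (g y) := by gcongr
      _ = 2 * ∫⁻ y in B, ∫⁻ _ in F ∩ B, ENNReal.ofReal (g y) := by
          simp_rw [setLIntegral_const]
          rw [lintegral_mul_const _ hg.ennreal_ofReal]
          ring
      _ ≤ _ := by
          refine mul_le_mul' le_rfl (lintegral_mono fun y => ?_)
          refine (setLIntegral_mono' (hF.inter measurableSet_ball) fun w hw => ?_).trans
            (lintegral_mono_set inter_subset_right)
          exact ENNReal.ofReal_le_ofReal (hgF y w hw.1)
  have i1 := half _ (hE t₁) h₁ (fun y => t₁ - u y) (by fun_prop) (fun y w hw => by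
    have hw : t₁ < u w := hw
    rw [abs_sub_comm]
    exact (by linarith : t₁ - u y ≤ u w - u y).trans (le_abs_self _))
  have i2 := half _ (hE t₂).compl (by rw [halfExcess_compl (hE t₂)]; linarith)
    (fun y => u y - t₂) (by fun_prop) (fun y w hw => by
    have hw : u w ≤ t₂ := not_lt.1 hw
    exact (by linarith : u y - t₂ ≤ u y - u w).trans (le_abs_self _))
  have hpt : ∀ y, ENNReal.ofReal |u y - a| ≤ ENNReal.ofReal (t₁ - u y) + ENNReal.ofReal (u y - t₂)
      + ENNReal.ofReal (t₂ - t₁) := by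
    intro y
    have hle : |u y - a| ≤ max (t₁ - u y) 0 + max (u y - t₂) 0 + (t₂ - t₁) := by
      have e1 := le_max_left (t₁ - u y) 0
      have e2 := le_max_right (t₁ - u y) 0
      have e3 := le_max_left (u y - t₂) 0
      have e4 := le_max_right (u y - t₂) 0
      rw [abs_le]
      constructor <;> linarith
    refine (ENNReal.ofReal_le_ofReal hle).trans ?_
    refine ENNReal.ofReal_add_le.trans (add_le_add (ENNReal.ofReal_add_le.trans ?_) le_rfl)
    rw [ENNReal.ofReal_max, ENNReal.ofReal_max]
    simp
  calc volume B * ∫⁻ y in B, ENNReal.ofReal |u y - a|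
      ≤ volume B * ∫⁻ y in B, (ENNReal.ofReal (t₁ - u y) + ENNReal.ofReal (u y - t₂)
          + ENNReal.ofReal (t₂ - t₁)) := by
        gcongr with y; exact hpt y
    _ = volume B * (∫⁻ y in B, ENNReal.ofReal (t₁ - u y))
        + volume B * (∫⁻ y in B, ENNReal.ofReal (u y - t₂))
        + ENNReal.ofReal (t₂ - t₁) * volume B ^ 2 := by
        rw [lintegral_add_right _ measurable_const, lintegral_add_left (by fun_prop),
          setLIntegral_const]
        ring
    _ ≤ _ := by
        refine add_le_add ((add_le_add i1 i2).trans_eq ?_) le_rfl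
        ring

/-! ### Quasi-every point is a Lebesgue point -/

/-- The set where the approximate limit of `u` is `+∞` has vanishing content: it is contained in the
half density sets of all superlevel sets, whose perimeters are not bounded away from `0`. -/
lemma hausdorffContent_forall_halfExcess_eq_zero {n : ℕ} {δ τ α m : ℝ} (hτ : 0 < τ)
    {Ω : Set (EuclideanSpace ℝ (Fin n))} (hΩ : MeasurableSet Ω)
    (hΩd : ∀ x ∈ Ω, 0 < Metric.infDist x (frontier Ω))
    {u : EuclideanSpace ℝ (Fin n) → ℝ} (hu : Measurable u)
    (hfin : improvedEnergy δ τ Ω u ≠ ⊤) {L : ℝ≥0∞} (hL : L ≠ ⊤)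
    (hbox : ∀ t, m ≤ t → hausdorffContent α (halfDensitySet τ Ω {y | t < u y}) ≤
      L * levelEnergy δ τ Ω u t) :
    hausdorffContent α {x ∈ Ω | ∀ t : ℝ, ∃ᶠ r in 𝓝[>] (0 : ℝ),
      0 ≤ halfExcess {y | t < u y} x r} = 0 := by
  set S := {x ∈ Ω | ∀ t : ℝ, ∃ᶠ r in 𝓝[>] (0 : ℝ), 0 ≤ halfExcess {y | t < u y} x r} with hS
  have hsub : ∀ t, S ⊆ halfDensitySet τ Ω {y | t < u y} := by
    rintro t x ⟨hxΩ, hx⟩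
    have h1 : ∀ᶠ r in 𝓝[>] (0 : ℝ), r ≤ τ / 4 * Metric.infDist x (frontier Ω) := by
      refine mem_nhdsWithin_of_mem_nhds (Iic_mem_nhds ?_)
      have := hΩd x hxΩ
      positivity
    obtain ⟨r, hr, hrd, hr0⟩ := ((hx t).and_eventually (h1.and self_mem_nhdsWithin)).exists
    exact ⟨hxΩ, r, hr0, hrd, hr⟩
  by_contra hne
  refine hfin ?_
  have hκ : hausdorffContent α S / L ≠ 0 := by
    rw [Ne, ENNReal.div_eq_zero_iff]
    tauto
  rw [(measurable_levelEnergy_and_coarea δ τ hΩ hu).2, ← top_le_iff]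
  calc ⊤ = ∫⁻ _ in Ici m, hausdorffContent α S / L := by
        rw [setLIntegral_const, Real.volume_Ici, ENNReal.mul_top hκ]
    _ ≤ ∫⁻ t in Ici m, levelEnergy δ τ Ω u t := by
        refine setLIntegral_mono' measurableSet_Ici fun t ht => ?_
        exact ENNReal.div_le_of_le_mul' ((hausdorffContent_mono α (hsub t)).trans (hbox t ht))
    _ ≤ _ := setLIntegral_le_lintegral _ _

lemma hausdorffContent_iUnion_eq_zero {n : ℕ} {ι : Type*} [Countable ι] {α : ℝ} (hα : 0 < α)
    {U : ι → Set (EuclideanSpace ℝ (Fin n))} (h : ∀ i, hausdorffContent α (U i) = 0) :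
    hausdorffContent α (⋃ i, U i) = 0 := by
  refine nonpos_iff_eq_zero.1 ((hausdorffContent_iUnion_le hα U).trans ?_)
  simp [h]

/-- If the oscillation of `u` in small balls is small and, for levels `t` arbitrarily close to `a`,
`{u > t}` fills at least half of the small balls if `t` is below `a` and at most half if `t` is above
`a`, then `a` is the Lebesgue value of `u`. -/
lemma HasLebesgueValue.of_forall_eventually {n : ℕ} {u : EuclideanSpace ℝ (Fin n) → ℝ}
    (hu : Measurable u) {x : EuclideanSpace ℝ (Fin n)} {a : ℝ}
    (hosc : ∀ c : ℝ, 0 < c → ∀ᶠ r in 𝓝[>] (0 : ℝ), ∫⁻ y in Metric.ball x r,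
      ∫⁻ w in Metric.ball x r, ENNReal.ofReal |u y - u w| < ENNReal.ofReal (c * r ^ (2 * n)))
    (h₁ : ∀ ε > 0, ∃ t, a - ε < t ∧ t ≤ a ∧
      ∀ᶠ r in 𝓝[>] (0 : ℝ), 0 ≤ halfExcess {y | t < u y} x r)
    (h₂ : ∀ ε > 0, ∃ t, t < a + ε ∧ a ≤ t ∧
      ∀ᶠ r in 𝓝[>] (0 : ℝ), halfExcess {y | t < u y} x r ≤ 0) :
    HasLebesgueValue u x a := by
  set v := volume.real (Metric.ball (0 : EuclideanSpace ℝ (Fin n)) 1) with hv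
  have hv0 : 0 < v := volume_real_unitBall_pos n
  refine tendsto_order.2 ⟨fun b hb => Eventually.of_forall fun r => hb.trans_le ?_, fun ε hε => ?_⟩
  · exact integral_nonneg fun y => abs_nonneg _
  obtain ⟨t₁, ht₁, ht₁a, he₁⟩ := h₁ (ε / 4) (by linarith)
  obtain ⟨t₂, ht₂, ht₂a, he₂⟩ := h₂ (ε / 4) (by linarith)
  filter_upwards [he₁, he₂, hosc (ε * v ^ 2 / 16) (by positivity), self_mem_nhdsWithin]
    with r hr₁ hr₂ hr hr0
  have hr0 : 0 < r := hr0
  have hV : volume (Metric.ball x r) = ENNReal.ofReal (v * r ^ n) := by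
    rw [← volume_real_ball x hr0, measureReal_def, ENNReal.ofReal_toReal measure_ball_lt_top.ne]
  have hVpos : 0 < v * r ^ n := by positivity
  have key := volume_mul_lintegral_abs_sub_le hu hr₁ hr₂ ht₁a ht₂a
  have hle : volume (Metric.ball x r) * ∫⁻ y in Metric.ball x r, ENNReal.ofReal |u y - a| ≤
      ENNReal.ofReal (v * r ^ n) * ENNReal.ofReal (3 * ε / 4 * (v * r ^ n)) := by
    refine key.trans ((add_le_add (mul_le_mul' le_rfl hr.le) le_rfl).trans ?_)
    rw [hV, ← ENNReal.ofReal_pow hVpos.le, ← ENNReal.ofReal_mul (by linarith),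
      show (4 : ℝ≥0∞) = ENNReal.ofReal 4 by simp, ← ENNReal.ofReal_mul (by norm_num),
      ← ENNReal.ofReal_add (by positivity) (mul_nonneg (by linarith) (by positivity)),
      ← ENNReal.ofReal_mul hVpos.le]
    refine ENNReal.ofReal_le_ofReal ?_
    have e1 : r ^ (2 * n) = (r ^ n) ^ 2 := by rw [pow_mul']
    have e2 : t₂ - t₁ ≤ ε / 2 := by linarith
    have e3 : (t₂ - t₁) * (v * r ^ n) ^ 2 ≤ ε / 2 * (v * r ^ n) ^ 2 := by gcongr
    rw [e1]
    nlinarith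
  rw [hV, ENNReal.mul_le_mul_iff_right (by simpa using hVpos) ENNReal.ofReal_ne_top] at hle
  rw [setAverage_eq, volume_real_ball x hr0, smul_eq_mul, inv_mul_lt_iff₀ hVpos,
    integral_eq_lintegral_of_nonneg_ae (Eventually.of_forall fun y => abs_nonneg _)
      (by fun_prop)]
  refine (ENNReal.toReal_le_of_le_ofReal (by positivity) hle).trans_lt ?_
  nlinarith

/-- The points of `Ω` that are not Lebesgue points have vanishing content. Outside countably many
exceptional sets, the oscillation in small balls tends to `0` and each set `{u > t}`, with `t` in a
dense set, eventually fills either more or less than half of the small balls; the Lebesgue value is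
the cut between the two cases. -/
lemma hausdorffContent_not_lebesgue_eq_zero {n : ℕ} (hn : 1 ≤ n) {δ τ α : ℝ}
    (hδ : δ ∈ Ioo (0 : ℝ) 1) (hτ : τ ∈ Ioo (0 : ℝ) 1) (hα : (n : ℝ) - δ ≤ α)
    {Ω : Set (EuclideanSpace ℝ (Fin n))} (hΩ : MeasurableSet Ω)
    (hΩd : ∀ x ∈ Ω, 0 < Metric.infDist x (frontier Ω))
    {u : EuclideanSpace ℝ (Fin n) → ℝ} (hu : Measurable u) (hui : LocallyIntegrable u)
    (hfin : improvedEnergy δ τ Ω u ≠ ⊤)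
    (hpos : hausdorffContent α {x ∈ Ω | ∀ t : ℝ, ∃ᶠ r in 𝓝[>] (0 : ℝ),
      0 ≤ halfExcess {y | t < u y} x r} = 0)
    (hneg : hausdorffContent α {x ∈ Ω | ∀ t : ℝ, ∃ᶠ r in 𝓝[>] (0 : ℝ),
      0 ≤ halfExcess {y | t < - u y} x r} = 0) :
    hausdorffContent α {x ∈ Ω | ∀ a, ¬ HasLebesgueValue u x a} = 0 := by
  have hn' : (1 : ℝ) ≤ n := by exact_mod_cast hn
  have hα0 : 0 < α := by linarith [hδ.2]
  obtain ⟨hmeas, hcoarea⟩ := measurable_levelEnergy_and_coarea δ τ hΩ hu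
  have hdense : Dense {t | levelEnergy δ τ Ω u t < ⊤} :=
    Measure.dense_of_ae (ae_lt_top hmeas (hcoarea ▸ hfin))
  obtain ⟨T, hTsub, hTc, hTd⟩ := hdense.exists_countable_dense_subset
  have hTd' : ∀ a b : ℝ, a < b → ∃ t ∈ T, a < t ∧ t < b := fun a b hab =>
    let ⟨t, ht, h⟩ := hTd.exists_between hab
    ⟨t, ht, h.1, h.2⟩
  have : Countable T := hTc
  have hE : ∀ t, MeasurableSet {y | t < u y} := fun t => measurableSet_lt measurable_const hu
  set v := volume.real (Metric.ball (0 : EuclideanSpace ℝ (Fin n)) 1) with hv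
  have hv0 : 0 < v := volume_real_unitBall_pos n
  let S : ℝ → (EuclideanSpace ℝ (Fin n) → ℝ) → Set (EuclideanSpace ℝ (Fin n)) := fun c w =>
    {x ∈ Ω | ∃ᶠ r in 𝓝[>] (0 : ℝ), ENNReal.ofReal (c * r ^ (2 * n)) ≤
      ∫⁻ y in Metric.ball x r, ∫⁻ z in Metric.ball x r, ENNReal.ofReal |w y - w z|}
  have N₁ : hausdorffContent α (⋃ k : ℕ, S (1 / ((k : ℝ) + 1)) u) = 0 :=
    hausdorffContent_iUnion_eq_zero hα0 fun k =>
      hausdorffContent_frequently_osc_eq_zero hn hδ hτ hα hΩd hu hui hfin (by positivity)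
  have N₂ : hausdorffContent α (⋃ t : T, S (v ^ 2 / 4)
      ({y | (t : ℝ) < u y}.indicator fun _ => 1)) = 0 :=
    hausdorffContent_iUnion_eq_zero hα0 fun t =>
      hausdorffContent_frequently_osc_eq_zero hn hδ hτ hα hΩd (measurable_const.indicator (hE t))
        ((locallyIntegrable_const 1).indicator (hE t)) (hTsub t.2).ne (by positivity)
  set N := (⋃ k : ℕ, S (1 / ((k : ℝ) + 1)) u) ∪
    (⋃ t : T, S (v ^ 2 / 4) ({y | (t : ℝ) < u y}.indicator fun _ => 1)) ∪
    ({x ∈ Ω | ∀ t : ℝ, ∃ᶠ r in 𝓝[>] (0 : ℝ), 0 ≤ halfExcess {y | t < u y} x r} ∪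
    {x ∈ Ω | ∀ t : ℝ, ∃ᶠ r in 𝓝[>] (0 : ℝ), 0 ≤ halfExcess {y | t < - u y} x r}) with hN
  have hN0 : hausdorffContent α N = 0 := by
    refine nonpos_iff_eq_zero.1 ((hausdorffContent_union_le hα0 _ _).trans ?_)
    refine (add_le_add (hausdorffContent_union_le hα0 _ _)
      (hausdorffContent_union_le hα0 _ _)).trans ?_
    rw [N₁, N₂, hpos, hneg]; simp
  refine nonpos_iff_eq_zero.1 ((hausdorffContent_mono α ?_).trans hN0.le)
  rintro x ⟨hxΩ, hx⟩
  by_contra hxN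
  simp only [hN, mem_union, mem_iUnion, not_or, not_exists] at hxN
  obtain ⟨⟨h1, h2⟩, h3, h4⟩ := hxN
  have hosc : ∀ c : ℝ, 0 < c → ∀ᶠ r in 𝓝[>] (0 : ℝ), ∫⁻ y in Metric.ball x r,
      ∫⁻ w in Metric.ball x r, ENNReal.ofReal |u y - u w| < ENNReal.ofReal (c * r ^ (2 * n)) := by
    intro c hc
    obtain ⟨k, hk⟩ := exists_nat_one_div_lt hc
    have h1k : ¬ ∃ᶠ r in 𝓝[>] (0 : ℝ), _ := fun h => h1 k ⟨hxΩ, h⟩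
    rw [not_frequently] at h1k
    filter_upwards [h1k, self_mem_nhdsWithin] with r hr hr0
    have hr0 : 0 < r := hr0
    refine (not_le.1 hr).trans_le (ENNReal.ofReal_le_ofReal ?_)
    gcongr
  have hcut : ∀ t ∈ T, (∀ᶠ r in 𝓝[>] (0 : ℝ), 0 < halfExcess {y | t < u y} x r) ∨
      ∀ᶠ r in 𝓝[>] (0 : ℝ), halfExcess {y | t < u y} x r < 0 := by
    intro t ht
    refine eventually_halfExcess_pos_or_neg hn (hE t) ?_
    have h2t : ¬ ∃ᶠ r in 𝓝[>] (0 : ℝ), _ := fun h => h2 ⟨t, ht⟩ ⟨hxΩ, h⟩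
    rw [not_frequently] at h2t
    filter_upwards [h2t, self_mem_nhdsWithin] with r hr hr0 h0
    exact hr (le_osc_indicator_of_halfExcess_eq_zero (hE t) hr0 h0)
  -- a level that is eventually on the upper side, and one on the lower side
  obtain ⟨b, hb⟩ : ∃ b : ℝ, ∀ᶠ r in 𝓝[>] (0 : ℝ), halfExcess {y | b < u y} x r < 0 := by
    by_contra! hcon
    exact h3 ⟨hxΩ, fun t => by simpa [not_eventually] using hcon t⟩
  obtain ⟨b', hb'⟩ : ∃ b : ℝ, ∀ᶠ r in 𝓝[>] (0 : ℝ), halfExcess {y | b < - u y} x r < 0 := by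
    by_contra! hcon
    exact h4 ⟨hxΩ, fun t => by simpa [not_eventually] using hcon t⟩
  let A : Set ℝ := {t ∈ T | ∀ᶠ r in 𝓝[>] (0 : ℝ), 0 < halfExcess {y | t < u y} x r}
  have hAne : A.Nonempty := by
    obtain ⟨t, ht, -, htb⟩ := hTd' (-b' - 1) (-b') (by linarith)
    refine ⟨t, ht, ?_⟩
    filter_upwards [hb'] with r hr
    have hc := halfExcess_compl (hE t) x r
    have hm : halfExcess {y | t < u y}ᶜ x r ≤ halfExcess {y | b' < - u y} x r := by
      refine halfExcess_mono (fun y hy => ?_) x r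
      have hy : u y ≤ t := not_lt.1 hy
      show b' < - u y
      linarith
    linarith
  have hlevel : ∀ {s t : ℝ}, s ≤ t → ∀ r, halfExcess {y | t < u y} x r ≤
      halfExcess {y | s < u y} x r := fun hst r =>
    halfExcess_mono (fun y hy => lt_of_le_of_lt hst hy) x r
  have hAbdd : BddAbove A := by
    refine ⟨b, fun t ht => ?_⟩
    by_contra! hbt
    obtain ⟨r, hr1, hr2⟩ := (ht.2.and hb).exists
    have := hlevel hbt.le r
    linarith
  refine hx (sSup A) (HasLebesgueValue.of_forall_eventually hu hosc (fun ε hε => ?_)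
    fun ε hε => ?_)
  · obtain ⟨t, htA, ht⟩ := exists_lt_of_lt_csSup hAne (show sSup A - ε < sSup A by linarith)
    exact ⟨t, ht, le_csSup hAbdd htA, htA.2.mono fun r hr => hr.le⟩
  · obtain ⟨t, htT, ht1, ht2⟩ := hTd' (sSup A) (sSup A + ε) (by linarith)
    refine ⟨t, ht2, ht1.le, ?_⟩
    rcases hcut t htT with h | h
    · exact absurd (le_csSup hAbdd (⟨htT, h⟩ : t ∈ A)) (not_le.2 ht1)
    · exact h.mono fun r hr => hr.le

/-! ### Medians -/

/-- A median is found as the infimum of the points where the distribution function is at least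
`1 / 2`. -/
lemma exists_median_of_isProbabilityMeasure (P : Measure ℝ) [IsProbabilityMeasure P] :
    ∃ m : ℝ, P.real (Ioi m) ≤ 1 / 2 ∧ P.real (Iio m) ≤ 1 / 2 := by
  set F := ProbabilityTheory.cdf P with hF
  have hmono : Monotone F := ProbabilityTheory.monotone_cdf P
  have htop : Tendsto F atTop (𝓝 1) := ProbabilityTheory.tendsto_cdf_atTop P
  have hbot : Tendsto F atBot (𝓝 0) := ProbabilityTheory.tendsto_cdf_atBot P
  let A : Set ℝ := {t | 1 / 2 ≤ F t}
  have hne : A.Nonempty := (htop.eventually_const_le (by norm_num)).exists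
  have hbdd : BddBelow A := by
    obtain ⟨b, hb⟩ := (hbot.eventually_lt_const (show (0 : ℝ) < 1 / 2 by norm_num)).exists
    refine ⟨b, fun t ht => ?_⟩
    by_contra! h
    have ht : 1 / 2 ≤ F t := ht
    have := hmono h.le
    linarith
  have hlt : ∀ t, t < sInf A → F t < 1 / 2 := fun t ht => by
    by_contra! h
    exact absurd (csInf_le hbdd (show t ∈ A from h)) (not_le.2 ht)
  have hge : 1 / 2 ≤ F (sInf A) := by
    have hr : Tendsto F (𝓝[>] (sInf A)) (𝓝 (F (sInf A))) :=
      (F.right_continuous (sInf A)).mono_left (nhdsWithin_mono _ Ioi_subset_Ici_self)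
    refine ge_of_tendsto hr ?_
    filter_upwards [self_mem_nhdsWithin] with t ht
    obtain ⟨b, hb, hbt⟩ := exists_lt_of_csInf_lt hne (show sInf A < t from ht)
    exact le_trans hb (hmono hbt.le)
  refine ⟨sInf A, ?_, ?_⟩
  · rw [← compl_Iic, measureReal_compl measurableSet_Iic, probReal_univ,
      ← ProbabilityTheory.cdf_eq_real]
    linarith
  · have h1 : P (Iio (sInf A)) = ENNReal.ofReal (Function.leftLim F (sInf A) - 0) := by
      rw [← F.measure_Iio hbot, hF, ProbabilityTheory.measure_cdf]
    have h2 : Function.leftLim F (sInf A) ≤ 1 / 2 := by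
      refine le_of_tendsto (hmono.tendsto_leftLim _) ?_
      filter_upwards [self_mem_nhdsWithin] with t ht
      exact (hlt t ht).le
    rw [measureReal_def, h1]
    exact ENNReal.toReal_le_of_le_ofReal (by norm_num) (ENNReal.ofReal_le_ofReal (by linarith))

lemma exists_median_ball {n : ℕ} {u : EuclideanSpace ℝ (Fin n) → ℝ} (hu : Measurable u)
    (z : EuclideanSpace ℝ (Fin n)) {r : ℝ} (hr : 0 < r) :
    ∃ m : ℝ, halfExcess {y | m < u y} z r ≤ 0 ∧ halfExcess {y | u y < m} z r ≤ 0 := by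
  have hB0 : volume (Metric.ball z r) ≠ 0 := (Metric.measure_ball_pos _ _ hr).ne'
  have hBt : volume (Metric.ball z r) ≠ ⊤ := measure_ball_lt_top.ne
  have hP : IsProbabilityMeasure (ProbabilityTheory.cond volume (Metric.ball z r)) :=
    ProbabilityTheory.cond_isProbabilityMeasure_of_finite hB0 hBt
  have hP' := Measure.isProbabilityMeasure_map (μ := ProbabilityTheory.cond volume
    (Metric.ball z r)) hu.aemeasurable
  obtain ⟨m, h1, h2⟩ := exists_median_of_isProbabilityMeasure
    ((ProbabilityTheory.cond volume (Metric.ball z r)).map u)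
  have hvpos : 0 < volume.real (Metric.ball z r) := ENNReal.toReal_pos hB0 hBt
  have key : ∀ I : Set ℝ, MeasurableSet I →
      ((ProbabilityTheory.cond volume (Metric.ball z r)).map u).real I ≤ 1 / 2 →
      halfExcess (u ⁻¹' I) z r ≤ 0 := by
    intro I hI h
    rw [map_measureReal_apply hu hI, measureReal_def, ProbabilityTheory.cond_apply
      measurableSet_ball, ENNReal.toReal_mul, ENNReal.toReal_inv, inter_comm] at h
    simp only [← measureReal_def] at h
    rw [inv_mul_le_iff₀ hvpos] at h
    rw [halfExcess]
    linarith
  exact ⟨m, key _ measurableSet_Ioi h1, key _ measurableSet_Iio h2⟩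

/-! ### Integration over the levels -/

lemma lintegral_hausdorffContent_superlevel_le {n : ℕ} {δ τ α m : ℝ} (hτ : 0 < τ) (hα : 0 < α)
    {Ω : Set (EuclideanSpace ℝ (Fin n))} (hΩ : MeasurableSet Ω)
    (hΩd : ∀ x ∈ Ω, 0 < Metric.infDist x (frontier Ω))
    {u ustar : EuclideanSpace ℝ (Fin n) → ℝ} (hu : Measurable u) (hui : LocallyIntegrable u)
    (hstar : ∀ x ∈ Ω, ∀ a, HasLebesgueValue u x a → ustar x = a)
    (hnull : hausdorffContent α {x ∈ Ω | ∀ a, ¬ HasLebesgueValue u x a} = 0) {L : ℝ≥0∞}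
    (hbox : ∀ t, m ≤ t → hausdorffContent α (halfDensitySet τ Ω {y | t < u y}) ≤
      L * levelEnergy δ τ Ω u t) :
    ∫⁻ t in Ioi (0 : ℝ), hausdorffContent α {x ∈ Ω | t < ustar x - m} ≤
      L * improvedEnergy δ τ Ω u := by
  obtain ⟨hmeas, hcoarea⟩ := measurable_levelEnergy_and_coarea δ τ hΩ hu
  have hpt : ∀ t : ℝ, 0 < t → hausdorffContent α {x ∈ Ω | t < ustar x - m} ≤
      L * levelEnergy δ τ Ω u (m + t) := by
    intro t ht
    have hsub : {x ∈ Ω | t < ustar x - m} ⊆ {x ∈ Ω | ∀ a, ¬ HasLebesgueValue u x a} ∪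
        halfDensitySet τ Ω {y | m + t < u y} := by
      rintro x ⟨hxΩ, hx⟩
      by_cases h : ∀ a, ¬ HasLebesgueValue u x a
      · exact Or.inl ⟨hxΩ, h⟩
      · push Not at h
        obtain ⟨a, ha⟩ := h
        have hxa := hstar x hxΩ a ha
        have h0 := ha.eventually_halfExcess_pos hu hui (t := m + t) (by linarith)
        have h1 : ∀ᶠ r in 𝓝[>] (0 : ℝ), r ≤ τ / 4 * Metric.infDist x (frontier Ω) := by
          refine mem_nhdsWithin_of_mem_nhds (Iic_mem_nhds ?_)
          have := hΩd x hxΩ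
          positivity
        obtain ⟨r, hr, hrd, hr0⟩ := (h0.and (h1.and self_mem_nhdsWithin)).exists
        exact Or.inr ⟨hxΩ, r, hr0, hrd, hr.le⟩
    refine (hausdorffContent_mono α hsub).trans ((hausdorffContent_union_le hα _ _).trans ?_)
    rw [hnull, zero_add]
    exact hbox _ (by linarith)
  calc _ ≤ ∫⁻ t in Ioi (0 : ℝ), L * levelEnergy δ τ Ω u (m + t) :=
        setLIntegral_mono' measurableSet_Ioi hpt
    _ ≤ ∫⁻ t, L * levelEnergy δ τ Ω u (m + t) := setLIntegral_le_lintegral _ _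
    _ = L * improvedEnergy δ τ Ω u := by
        rw [lintegral_add_left_eq_self (fun t => L * levelEnergy δ τ Ω u t) m,
          lintegral_const_mul _ hmeas, hcoarea]

lemma measurable_hausdorffContent_superlevel {n : ℕ} (α : ℝ) (Ω : Set (EuclideanSpace ℝ (Fin n)))
    (g : EuclideanSpace ℝ (Fin n) → ℝ) :
    Measurable fun t : ℝ => hausdorffContent α {x ∈ Ω | t < g x} :=
  Antitone.measurable fun _ _ hst => hausdorffContent_mono α fun _ hx =>
    ⟨hx.1, lt_of_le_of_lt hst hx.2⟩

lemma choquetIntegral_le_add_neg {n : ℕ} {α : ℝ} (hα : 0 < α) (Ω : Set (EuclideanSpace ℝ (Fin n)))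
    (g : EuclideanSpace ℝ (Fin n) → ℝ) :
    choquetIntegral α Ω g ≤ (∫⁻ t in Ioi (0 : ℝ), hausdorffContent α {x ∈ Ω | t < g x}) +
      ∫⁻ t in Ioi (0 : ℝ), hausdorffContent α {x ∈ Ω | t < - g x} := by
  rw [choquetIntegral, ← lintegral_add_left (measurable_hausdorffContent_superlevel α Ω g)]
  refine lintegral_mono fun t => ?_
  refine (hausdorffContent_mono α ?_).trans (hausdorffContent_union_le hα _ _)
  rintro x ⟨hxΩ, hx⟩
  rcases lt_abs.1 hx with h | h
  · exact Or.inl ⟨hxΩ, h⟩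
  · exact Or.inr ⟨hxΩ, h⟩

/-- Changing the constant subtracted from `g` shifts the levels by at most `|a - b|`. -/
lemma choquetIntegral_sub_le {n : ℕ} {α : ℝ} (Ω : Set (EuclideanSpace ℝ (Fin n)))
    (g : EuclideanSpace ℝ (Fin n) → ℝ) (a b : ℝ) :
    choquetIntegral α Ω (fun x => g x - b) ≤ choquetIntegral α Ω (fun x => g x - a) +
      ENNReal.ofReal |a - b| * hausdorffContent α Ω := by
  set κ := |a - b| with hκ
  let h : ℝ → ℝ≥0∞ := fun t => hausdorffContent α {x ∈ Ω | t < |g x - a|}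
  have hpt : ∀ t ∈ Ioi (0 : ℝ), hausdorffContent α {x ∈ Ω | t < |g x - b|} ≤
      (Ioi (0 : ℝ)).indicator h (t - κ) +
        (Ioc 0 κ).indicator (fun _ => hausdorffContent α Ω) t := by
    intro t ht
    have ht : 0 < t := ht
    rcases le_or_gt t κ with htκ | htκ
    · rw [indicator_of_mem (show t ∈ Ioc 0 κ from ⟨ht, htκ⟩)]
      exact (hausdorffContent_mono α (sep_subset _ _)).trans le_add_self
    · rw [indicator_of_mem (show t - κ ∈ Ioi (0 : ℝ) from sub_pos.2 htκ)]
      refine (hausdorffContent_mono α ?_).trans le_self_add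
      rintro x ⟨hxΩ, hx⟩
      refine ⟨hxΩ, ?_⟩
      have := abs_sub_le (g x) a b
      linarith
  calc _ ≤ ∫⁻ t in Ioi (0 : ℝ), ((Ioi (0 : ℝ)).indicator h (t - κ) +
        (Ioc 0 κ).indicator (fun _ => hausdorffContent α Ω) t) :=
        setLIntegral_mono' measurableSet_Ioi hpt
    _ ≤ ∫⁻ t, ((Ioi (0 : ℝ)).indicator h (t - κ) +
        (Ioc 0 κ).indicator (fun _ => hausdorffContent α Ω) t) := setLIntegral_le_lintegral _ _
    _ = _ := by
        rw [lintegral_add_right _ (measurable_const.indicator measurableSet_Ioc),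
          lintegral_sub_right_eq_self (fun t => (Ioi (0 : ℝ)).indicator h t) κ,
          lintegral_indicator measurableSet_Ioi, lintegral_indicator_const measurableSet_Ioc,
          Real.volume_Ioc, sub_zero, mul_comm]
        rfl

/-! ### Comparison of the mean and the median -/

lemma ae_hasLebesgueValue {n : ℕ} (hn : 1 ≤ n) {u : EuclideanSpace ℝ (Fin n) → ℝ}
    (hui : LocallyIntegrable u) : ∀ᵐ x, HasLebesgueValue u x (u x) := by
  have : Nonempty (Fin n) := ⟨⟨0, hn⟩⟩
  filter_upwards [IsUnifLocDoublingMeasure.ae_tendsto_average_norm_sub volume hui 1] with x hx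
  have h1 := hx (l := 𝓝[>] (0 : ℝ)) (fun _ => x) id tendsto_id (by
    filter_upwards [self_mem_nhdsWithin] with r hr
    exact Metric.mem_closedBall_self (by simpa using (le_of_lt hr : (0 : ℝ) ≤ r)))
  refine h1.congr fun r => ?_
  have hae : (Metric.ball x r : Set (EuclideanSpace ℝ (Fin n))) =ᵐ[volume]
      Metric.closedBall x r := by
    rw [← Metric.ball_union_sphere]
    exact (union_ae_eq_left_of_ae_eq_empty
      (ae_eq_empty.2 (Measure.addHaar_sphere volume x r))).symm
  rw [id, Measure.restrict_congr_set hae]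
  rfl

/-- The distance of the mean to `m` is at most the mean of `|u - m|`, which the Choquet integral
controls because Lebesgue measure is bounded by the content. -/
lemma ofReal_abs_sub_average_mul_volume_le {n : ℕ} (hn : 1 ≤ n) {α m R : ℝ} (hα : 0 < α)
    (hαn : α ≤ n) (hR : 0 < R) {Ω : Set (EuclideanSpace ℝ (Fin n))}
    {z : EuclideanSpace ℝ (Fin n)} (hΩR : Ω ⊆ Metric.ball z R) (hΩ0 : volume Ω ≠ 0)
    {u ustar : EuclideanSpace ℝ (Fin n) → ℝ} (hu : Measurable u) (hui : LocallyIntegrable u)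
    (huΩ : IntegrableOn u Ω)
    (hstar : ∀ x ∈ Ω, ∀ a, HasLebesgueValue u x a → ustar x = a) :
    ENNReal.ofReal |m - ⨍ y in Ω, u y| * volume Ω ≤
      volume (Metric.ball (0 : EuclideanSpace ℝ (Fin n)) 1) *
        ENNReal.ofReal (R ^ ((n : ℝ) - α) / omegaConst α) *
        choquetIntegral α Ω (fun x => ustar x - m) := by
  have hΩt : volume Ω ≠ ⊤ := measure_ne_top_of_subset hΩR measure_ball_lt_top.ne
  have hmean : ENNReal.ofReal |m - ⨍ y in Ω, u y| * volume Ω ≤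
      ∫⁻ y in Ω, ENNReal.ofReal |u y - m| := by
    have hvpos : 0 < volume.real Ω := ENNReal.toReal_pos hΩ0 hΩt
    have hc : IntegrableOn (fun _ : EuclideanSpace ℝ (Fin n) => m) Ω := integrableOn_const hΩt
    have e1 : ∫ y in Ω, (m - u y) = volume.real Ω * (m - ⨍ y in Ω, u y) := by
      rw [integral_sub hc huΩ, setAverage_eq, setIntegral_const, smul_eq_mul, smul_eq_mul]
      field_simp
    calc _ = ‖∫ y in Ω, (m - u y)‖ₑ := by
          rw [e1, enorm_mul, Real.enorm_eq_ofReal_abs, Real.enorm_eq_ofReal_abs,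
            abs_of_pos hvpos, measureReal_def, ENNReal.ofReal_toReal hΩt, mul_comm]
      _ ≤ ∫⁻ y in Ω, ‖m - u y‖ₑ := enorm_integral_le_lintegral_enorm _
      _ = _ := by
          simp_rw [Real.enorm_eq_ofReal_abs, abs_sub_comm]
  refine hmean.trans ?_
  rw [lintegral_eq_lintegral_meas_lt _ (Eventually.of_forall fun y => abs_nonneg _)
    (by fun_prop), choquetIntegral, ← lintegral_const_mul _
    (measurable_hausdorffContent_superlevel α Ω fun x => |ustar x - m|)]
  refine lintegral_mono fun t => ?_
  rw [Measure.restrict_apply (measurableSet_lt measurable_const (by fun_prop))]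
  have hle : volume ({y | t < |u y - m|} ∩ Ω) ≤ volume {x ∈ Ω | t < |ustar x - m|} := by
    refine measure_mono_ae ?_
    filter_upwards [ae_hasLebesgueValue hn hui] with x hx hxt
    refine ⟨hxt.2, ?_⟩
    rw [hstar x hxt.2 _ hx]
    exact hxt.1
  exact hle.trans (volume_le_hausdorffContent hα hαn hR ((sep_subset _ _).trans hΩR))

/-! ### The functional Boxing inequality -/

lemma HasLebesgueValue.neg {n : ℕ} {u : EuclideanSpace ℝ (Fin n) → ℝ}
    {x : EuclideanSpace ℝ (Fin n)} {a : ℝ} (h : HasLebesgueValue u x a) :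
    HasLebesgueValue (fun y => - u y) x (-a) := by
  refine h.congr fun r => ?_
  congr 1
  ext y
  rw [neg_sub_neg, abs_sub_comm]

/-- The Boxing inequality for the distance to a value `m` such that the superlevel sets above `m`
and the sublevel sets below `m` satisfy the Boxing inequality for sets. -/
lemma choquetIntegral_sub_le_two_mul {n : ℕ} (hn : 1 ≤ n) {δ τ α m : ℝ}
    (hδ : δ ∈ Ioo (0 : ℝ) 1) (hτ : τ ∈ Ioo (0 : ℝ) 1) (hα : (n : ℝ) - δ ≤ α)
    {Ω : Set (EuclideanSpace ℝ (Fin n))} (hΩ : MeasurableSet Ω)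
    (hΩd : ∀ x ∈ Ω, 0 < Metric.infDist x (frontier Ω))
    {u ustar : EuclideanSpace ℝ (Fin n) → ℝ} (hu : Measurable u) (hui : LocallyIntegrable u)
    (hfin : improvedEnergy δ τ Ω u ≠ ⊤)
    (hstar : ∀ x ∈ Ω, ∀ a, HasLebesgueValue u x a → ustar x = a) {L : ℝ≥0∞} (hL : L ≠ ⊤)
    (hbox : ∀ t, m ≤ t → hausdorffContent α (halfDensitySet τ Ω {y | t < u y}) ≤
      L * levelEnergy δ τ Ω u t)
    (hbox' : ∀ t, -m ≤ t → hausdorffContent α (halfDensitySet τ Ω {y | t < - u y}) ≤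
      L * levelEnergy δ τ Ω (fun x => - u x) t) :
    choquetIntegral α Ω (fun x => ustar x - m) ≤ 2 * (L * improvedEnergy δ τ Ω u) := by
  have hn' : (1 : ℝ) ≤ n := by exact_mod_cast hn
  have hα0 : 0 < α := by linarith [hδ.2]
  have hfin' : improvedEnergy δ τ Ω (fun x => - u x) ≠ ⊤ := by rwa [improvedEnergy_neg]
  have hnull : hausdorffContent α {x ∈ Ω | ∀ a, ¬ HasLebesgueValue u x a} = 0 :=
    hausdorffContent_not_lebesgue_eq_zero hn hδ hτ hα hΩ hΩd hu hui hfin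
      (hausdorffContent_forall_halfExcess_eq_zero hτ.1 hΩ hΩd hu hfin hL hbox)
      (hausdorffContent_forall_halfExcess_eq_zero hτ.1 hΩ hΩd hu.neg hfin' hL hbox')
  have hLV : ∀ x a, HasLebesgueValue (fun y => - u y) x a → HasLebesgueValue u x (-a) := by
    intro x a h
    simpa using h.neg
  have hnull' : hausdorffContent α {x ∈ Ω | ∀ a, ¬ HasLebesgueValue (fun y => - u y) x a} = 0 := by
    refine nonpos_iff_eq_zero.1 ((hausdorffContent_mono α ?_).trans hnull.le)
    rintro x ⟨hxΩ, hx⟩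
    exact ⟨hxΩ, fun a ha => hx (-a) ha.neg⟩
  have h1 := lintegral_hausdorffContent_superlevel_le hτ.1 hα0 hΩ hΩd hu hui hstar hnull hbox
  have h2 := lintegral_hausdorffContent_superlevel_le (u := fun x => - u x) (ustar := fun x => - ustar x)
    hτ.1 hα0 hΩ hΩd hu.neg hui.neg (fun x hx a ha => by rw [hstar x hx _ (hLV x a ha), neg_neg]) hnull' hbox'
  rw [improvedEnergy_neg] at h2
  refine (choquetIntegral_le_add_neg hα0 _ _).trans ?_
  rw [two_mul]
  refine add_le_add h1 (le_trans (le_of_eq ?_) h2)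
  have e : ∀ x, -(ustar x - m) = -ustar x - -m := fun x => by ring
  simp_rw [e]

lemma HasLebesgueValue.congr_of_ae_restrict {n : ℕ} {Ω : Set (EuclideanSpace ℝ (Fin n))}
    (hΩ : IsOpen Ω) {f u : EuclideanSpace ℝ (Fin n) → ℝ} (h : f =ᵐ[volume.restrict Ω] u)
    {x : EuclideanSpace ℝ (Fin n)} (hx : x ∈ Ω) {a : ℝ} (ha : HasLebesgueValue f x a) :
    HasLebesgueValue u x a := by
  refine Tendsto.congr' ?_ ha
  obtain ⟨ε, hε, hεΩ⟩ := Metric.isOpen_iff.1 hΩ x hx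
  filter_upwards [mem_nhdsWithin_of_mem_nhds (Iic_mem_nhds hε)] with r hr
  refine average_congr ?_
  filter_upwards [ae_mono (Measure.restrict_mono
    ((Metric.ball_subset_ball hr).trans hεΩ) le_rfl) h] with y hy
  rw [hy]

/-- The geometric facts about a John domain of diameter `D` that are used: it is bounded, the
distance to the boundary is positive and at most `D`, and it contains a ball around the center of
radius comparable to `D ^ s`. -/
lemma IsDistanceJohnDomain.exists_center {n : ℕ} (hn : 1 ≤ n) {s CJ : ℝ}
    {Ω : Set (EuclideanSpace ℝ (Fin n))} (h : IsDistanceJohnDomain s CJ Ω) :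
    0 < Metric.diam Ω ∧ (∀ x ∈ Ω, 0 < Metric.infDist x (frontier Ω)) ∧
    (∀ x ∈ Ω, Metric.infDist x (frontier Ω) ≤ Metric.diam Ω) ∧
    ∃ xJ ∈ Ω, Ω ⊆ Metric.ball xJ (2 * Metric.diam Ω) ∧
      Metric.ball xJ ((Metric.diam Ω / 4) ^ s / CJ) ⊆ Ω ∧
      ∀ x ∈ Ω, ∃ γ : ℝ → EuclideanSpace ℝ (Fin n),
        ContinuousOn γ (Icc 0 1) ∧ MapsTo γ (Icc 0 1) Ω ∧ γ 0 = x ∧ γ 1 = xJ ∧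
        ∀ t ∈ Icc (0 : ℝ) 1, dist (γ t) x ^ s < CJ * Metric.infDist (γ t) (frontier Ω) := by
  have : Nonempty (Fin n) := ⟨⟨0, hn⟩⟩
  obtain ⟨hΩo, hΩc, hΩb, hs, hCJ, xJ, hxJ, hJ⟩ := h
  have hCJ0 : 0 < CJ := by linarith
  have hD : 0 < Metric.diam Ω := by
    by_contra hD
    have hsub : Ω ⊆ {xJ} := fun x hx => by
      have := Metric.dist_le_diam_of_mem hΩb hx hxJ
      exact dist_le_zero.1 (by linarith)
    have h0 : volume Ω = 0 := measure_mono_null hsub (measure_singleton _)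
    exact (hΩo.measure_pos volume ⟨xJ, hxJ⟩).ne' h0
  have hd : ∀ x ∈ Ω, 0 < Metric.infDist x (frontier Ω) := by
    intro x hx
    obtain ⟨γ, -, -, -, hγ0, -, hγJ⟩ := hJ x hx
    have h0 := hγJ 0 (by simp)
    rw [hγ0, dist_self, Real.zero_rpow (by linarith)] at h0
    exact (pos_iff_pos_of_mul_pos h0).1 hCJ0
  refine ⟨hD, hd, ?_, xJ, hxJ, ?_, ?_, ?_⟩
  · intro x hx
    have hne : (frontier Ω).Nonempty := by
      by_contra hne
      have := hd x hx
      rw [not_nonempty_iff_eq_empty.1 hne, Metric.infDist_empty] at this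
      exact lt_irrefl _ this
    obtain ⟨w, hw⟩ := hne
    refine (Metric.infDist_le_dist_of_mem hw).trans ?_
    rw [← Metric.diam_closure]
    exact Metric.dist_le_diam_of_mem hΩb.closure (subset_closure hx) (frontier_subset_closure hw)
  · intro x hx
    rw [Metric.mem_ball]
    have := Metric.dist_le_diam_of_mem hΩb hx hxJ
    linarith
  · -- some point of `Ω` has distance at least `D / 4` from the center
    obtain ⟨x, hx, hxD⟩ : ∃ x ∈ Ω, Metric.diam Ω / 4 ≤ dist xJ x := by
      by_contra! hcon
      have : Metric.diam Ω ≤ Metric.diam Ω / 2 := by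
        refine Metric.diam_le_of_forall_dist_le (by linarith) fun x hx y hy => ?_
        have h1 := hcon x hx
        have h2 := hcon y hy
        have := dist_triangle_left x y xJ
        linarith
      linarith
    obtain ⟨γ, -, -, -, -, hγ1, hγJ⟩ := hJ x hx
    have h1 := hγJ 1 (by simp)
    rw [hγ1] at h1
    refine (Metric.ball_subset_ball ?_).trans (ball_infDist_frontier_subset hxJ)
    rw [div_le_iff₀ hCJ0]
    calc (Metric.diam Ω / 4) ^ s ≤ dist xJ x ^ s := by gcongr
      _ ≤ _ := by linarith
  · intro x hx
    obtain ⟨γ, h1, -, h3, h4, h5, h6⟩ := hJ x hx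
    exact ⟨γ, h1, h3, h4, h5, h6⟩

lemma rpow_le_one_add_pow {n : ℕ} {x β : ℝ} (hx : 0 ≤ x) (hβ : 0 ≤ β) (hβn : β ≤ n) :
    x ^ β ≤ (1 + x) ^ n := by
  calc x ^ β ≤ (1 + x) ^ β := by gcongr; linarith
    _ ≤ (1 + x) ^ (n : ℝ) := Real.rpow_le_rpow_of_exponent_le (by linarith) hβn
    _ = _ := Real.rpow_natCast _ _

theorem mainTheorem1 (n : ℕ) (hn : 2 ≤ n) (τ s CJ D : ℝ) (hτ : τ ∈ Ioo (0 : ℝ) 1) :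
    ∃ C : ℝ, 0 < C ∧
      ∀ δ ∈ Ioo (0 : ℝ) 1, s ≤ (n : ℝ) / ((n : ℝ) - δ) →
      ∀ Ω : Set (EuclideanSpace ℝ (Fin n)), IsDistanceJohnDomain s CJ Ω → Metric.diam Ω = D →
      ∀ f : EuclideanSpace ℝ (Fin n) → ℝ, IntegrableOn f Ω →
      ∀ fstar : EuclideanSpace ℝ (Fin n) → ℝ, IsPreciseRepresentative Ω f fstar →
        choquetIntegral (s * ((n : ℝ) - δ)) Ω (fun x => fstar x - ⨍ y in Ω, f y) ≤
          ENNReal.ofReal (C * (1 - δ)) * improvedEnergy δ τ Ω f := by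
  by_cases hpar : 1 ≤ s ∧ 1 ≤ CJ ∧ 0 < D
  swap
  · refine ⟨1, one_pos, fun δ _ _ Ω hΩJ hΩD => absurd ?_ hpar⟩
    obtain ⟨hD, -⟩ := hΩJ.exists_center (by omega)
    obtain ⟨-, -, -, hs, hCJ, -⟩ := hΩJ
    exact ⟨hs, hCJ, hΩD ▸ hD⟩
  obtain ⟨hs, hCJ, hD⟩ := hpar
  have hn1 : 1 ≤ n := by omega
  have hn' : (1 : ℝ) ≤ n := by exact_mod_cast hn1
  have hCJ0 : 0 < CJ := by linarith
  have hτ0 := hτ.1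
  obtain ⟨a, b, ha, hab⟩ := exists_omegaConst_bounds n
  have hb : 0 < b := by
    have := hab 0 (by simp)
    linarith [this.1, this.2]
  set v := volume.real (Metric.ball (0 : EuclideanSpace ℝ (Fin n)) 1) with hv
  have hv0 : 0 < v := volume_real_unitBall_pos n
  set M := 4 * CJ / τ + D ^ (s - 1) with hM
  have hM0 : 0 < M := by positivity
  set ρ := (D / 4) ^ s / CJ with hρ
  have hρ0 : 0 < ρ := by positivity
  -- the constant of the Boxing inequality for sets
  set C₁ : ℝ := b * 6 ^ n * ((1 + M) ^ n * (2 ^ (n + 2) / (v ^ 2 / 4))) with hC₁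
  -- bounds the passage from the median to the mean
  set C₂ : ℝ := v * ((1 + 2 * D) ^ n / a) * (b * (1 + 2 * D) ^ n) / (v * ρ ^ n) with hC₂
  have hC₁0 : 0 < C₁ := by positivity
  have hC₂0 : 0 < C₂ := by positivity
  refine ⟨(1 + C₂) * (2 * C₁), by positivity, fun δ hδ hsδ Ω hΩJ hΩD f hf fstar hfstar => ?_⟩
  have hδ1 : 0 < 1 - δ := by linarith [hδ.2]
  have hnδ : 0 < (n : ℝ) - δ := by linarith
  obtain ⟨-, hd, hdD, xJ, hxJ, hball, hballΩ, hJ⟩ := hΩJ.exists_center hn1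
  rw [hΩD] at hdD hball hballΩ
  have hΩo : IsOpen Ω := hΩJ.1
  have hΩm : MeasurableSet Ω := hΩo.measurableSet
  set α := s * ((n : ℝ) - δ) with hα
  have hαδ : (n : ℝ) - δ ≤ α := by nlinarith
  have hα0 : 0 < α := by linarith
  have hαn : α ≤ n := by rwa [le_div_iff₀ hnδ] at hsδ
  have hω := hab α ⟨hα0.le, hαn⟩
  have hω0 := omegaConst_pos hα0.le
  by_cases hfin : improvedEnergy δ τ Ω f = ⊤
  · rw [hfin, ENNReal.mul_top]
    · exact le_top
    · rw [Ne, ENNReal.ofReal_eq_zero, not_le]; positivity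
  -- `u` is a measurable function that agrees with `f` almost everywhere on `Ω`
  set u : EuclideanSpace ℝ (Fin n) → ℝ := Ω.indicator (hf.1.mk f) with hudef
  have hu : Measurable u := (hf.1.stronglyMeasurable_mk.measurable).indicator hΩm
  have hfu : f =ᵐ[volume.restrict Ω] u :=
    hf.1.ae_eq_mk.trans (indicator_ae_eq_restrict hΩm).symm
  have huΩ : IntegrableOn u Ω := Integrable.congr hf hfu
  have hui : LocallyIntegrable u := by
    refine Integrable.locallyIntegrable ?_
    rw [hudef, integrable_indicator_iff hΩm]
    exact Integrable.congr hf hf.1.ae_eq_mk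
  have hE : improvedEnergy δ τ Ω f = improvedEnergy δ τ Ω u := improvedEnergy_congr_ae δ τ hfu
  have hmean : ⨍ y in Ω, f y = ⨍ y in Ω, u y := average_congr hfu
  have hstar : ∀ x ∈ Ω, ∀ a, HasLebesgueValue u x a → fstar x = a := fun x hx a h =>
    hfstar x hx a (h.congr_of_ae_restrict hΩo hfu.symm hx)
  rw [hE] at hfin
  rw [hE, hmean]
  obtain ⟨m, hm1, hm2⟩ := exists_median_ball hu xJ
    (r := τ / 4 * Metric.infDist xJ (frontier Ω)) (by have := hd xJ hxJ; positivity)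
  have hset : ∀ E : Set (EuclideanSpace ℝ (Fin n)), MeasurableSet E →
      halfExcess E xJ (τ / 4 * Metric.infDist xJ (frontier Ω)) ≤ 0 →
      hausdorffContent α (halfDensitySet τ Ω E) ≤ ENNReal.ofReal (C₁ * (1 - δ)) *
        improvedEnergy δ τ Ω (E.indicator fun _ => 1) := by
    intro E hEm hEc
    refine (hausdorffContent_le_energy_indicator hn1 hδ hτ hs hCJ0 hD hd hdD hJ hEm hEc).trans ?_
    rw [← mul_assoc, ← ENNReal.ofReal_mul (by positivity)]
    refine mul_le_mul' (ENNReal.ofReal_le_ofReal ?_) le_rfl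
    have e1 : (6 : ℝ) ^ α ≤ 6 ^ n := by
      rw [← Real.rpow_natCast]
      exact Real.rpow_le_rpow_of_exponent_le (by norm_num) hαn
    have e2 : M ^ ((n : ℝ) - δ) ≤ (1 + M) ^ n :=
      rpow_le_one_add_pow hM0.le hnδ.le (by linarith [hδ.1])
    calc omegaConst α * 6 ^ α * (M ^ ((n : ℝ) - δ) * (2 ^ (n + 2) / (v ^ 2 / 4) * (1 - δ)))
        ≤ b * 6 ^ n * ((1 + M) ^ n * (2 ^ (n + 2) / (v ^ 2 / 4) * (1 - δ))) := by
          gcongr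
          exact hω.2
      _ = C₁ * (1 - δ) := by rw [hC₁]; ring
  have hmed := choquetIntegral_sub_le_two_mul (m := m) hn1 hδ hτ hαδ hΩm hd hu hui hfin hstar
    (L := ENNReal.ofReal (C₁ * (1 - δ))) ENNReal.ofReal_ne_top
    (fun t ht => hset _ (measurableSet_lt measurable_const hu)
      ((halfExcess_mono (fun y hy => lt_of_le_of_lt ht hy) _ _).trans hm1))
    (fun t ht => hset _ (measurableSet_lt measurable_const hu.neg)
      ((halfExcess_mono (fun y (hy : t < - u y) => show u y < m by linarith) _ _).trans hm2))
  have hR0 : 0 < 2 * D := by linarith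
  have hvolball : ∀ (y : EuclideanSpace ℝ (Fin n)) (r : ℝ), 0 < r →
      volume (Metric.ball y r) = ENNReal.ofReal (v * r ^ n) := fun y r hr => by
    rw [← volume_real_ball y hr, measureReal_def, ENNReal.ofReal_toReal measure_ball_lt_top.ne]
  have hΩpos : ENNReal.ofReal (v * ρ ^ n) ≤ volume Ω := by
    rw [← hvolball xJ ρ hρ0]
    exact measure_mono hballΩ
  have hΩ0 : volume Ω ≠ 0 := (hΩo.measure_pos volume ⟨xJ, hxJ⟩).ne'
  have hκ := ofReal_abs_sub_average_mul_volume_le (m := m) hn1 hα0 hαn hR0 hball hΩ0 hu hui huΩ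
    hstar
  set J := choquetIntegral α Ω (fun x => fstar x - m) with hJdef
  set κ := |m - ⨍ y in Ω, u y| with hκdef
  have hHΩ : hausdorffContent α Ω ≤ ENNReal.ofReal (b * (1 + 2 * D) ^ n) := by
    refine (hausdorffContent_mono α hball).trans ((hausdorffContent_ball_le hα0 xJ hR0).trans ?_)
    refine ENNReal.ofReal_le_ofReal ?_
    have := rpow_le_one_add_pow hR0.le hα0.le hαn
    gcongr
    exact hω.2
  have hκ' : ENNReal.ofReal κ * ENNReal.ofReal (v * ρ ^ n) ≤
      ENNReal.ofReal (v * ((1 + 2 * D) ^ n / a)) * J := by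
    refine (mul_le_mul' le_rfl hΩpos).trans (hκ.trans (mul_le_mul' ?_ le_rfl))
    rw [hvolball 0 1 one_pos, ← ENNReal.ofReal_mul (by positivity)]
    refine ENNReal.ofReal_le_ofReal ?_
    have e := rpow_le_one_add_pow hR0.le (show 0 ≤ (n : ℝ) - α by linarith) (by linarith)
    rw [one_pow, mul_one]
    gcongr
    exact hω.1
  have hκH : ENNReal.ofReal κ * hausdorffContent α Ω ≤ ENNReal.ofReal C₂ * J := by
    have hvρ : 0 < v * ρ ^ n := by positivity
    have e : ENNReal.ofReal C₂ = ENNReal.ofReal (v * ((1 + 2 * D) ^ n / a)) *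
        ENNReal.ofReal (b * (1 + 2 * D) ^ n) * ENNReal.ofReal (v * ρ ^ n)⁻¹ := by
      rw [← ENNReal.ofReal_mul (by positivity), ← ENNReal.ofReal_mul (by positivity), hC₂,
        div_eq_mul_inv]
    have e' : ENNReal.ofReal (v * ρ ^ n) * ENNReal.ofReal (v * ρ ^ n)⁻¹ = 1 := by
      rw [← ENNReal.ofReal_mul hvρ.le, mul_inv_cancel₀ hvρ.ne', ENNReal.ofReal_one]
    calc ENNReal.ofReal κ * hausdorffContent α Ω
        ≤ ENNReal.ofReal κ * ENNReal.ofReal (b * (1 + 2 * D) ^ n) := by gcongr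
      _ = ENNReal.ofReal κ * ENNReal.ofReal (v * ρ ^ n) *
            (ENNReal.ofReal (b * (1 + 2 * D) ^ n) * ENNReal.ofReal (v * ρ ^ n)⁻¹) := by
          rw [mul_mul_mul_comm, e', mul_one]
      _ ≤ ENNReal.ofReal (v * ((1 + 2 * D) ^ n / a)) * J *
            (ENNReal.ofReal (b * (1 + 2 * D) ^ n) * ENNReal.ofReal (v * ρ ^ n)⁻¹) := by gcongr
      _ = ENNReal.ofReal C₂ * J := by rw [e]; ring
  calc choquetIntegral α Ω (fun x => fstar x - ⨍ y in Ω, u y)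
      ≤ J + ENNReal.ofReal κ * hausdorffContent α Ω := choquetIntegral_sub_le Ω fstar m _
    _ ≤ J + ENNReal.ofReal C₂ * J := by gcongr
    _ = ENNReal.ofReal (1 + C₂) * J := by
        rw [ENNReal.ofReal_add zero_le_one hC₂0.le, ENNReal.ofReal_one]; ring
    _ ≤ ENNReal.ofReal (1 + C₂) *
          (2 * (ENNReal.ofReal (C₁ * (1 - δ)) * improvedEnergy δ τ Ω u)) := by gcongr
    _ = _ := by
        rw [show (2 : ℝ≥0∞) = ENNReal.ofReal 2 by simp, ← mul_assoc, ← mul_assoc,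
          ← ENNReal.ofReal_mul (by positivity), ← ENNReal.ofReal_mul (by positivity)]
        congr 2; ring
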